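/- Let $A=\mathbb C[x_1,\dots,x_N]$ be the polynomial ring, graded by $\deg x_i=1$, with $\mathfrak m=(x_1,\dots,x_N)$. Let $G$ be a group acting linearly on $\mathbb C^N$ with finitely many orbits $\mathcal O_0,\dots,\mathcal O_t$ (for instance the group $G_0$ acting on $\mathfrak g_1$ for a grading of a simple Lie algebra, when this representation has finitely many orbits). Let $G$ act on $A$ by $(gf)(x)=f(g^{-1}x)$. Choose representatives $p_j\in\mathcal O_j$, and let $p$ be a representative of the dense orbit. Orbit closures are taken in the Zariski topology. Let $n\ge 1$ and let $$F_\bullet:\quad F_0\xleftarrow{\,d_1\,}F_1\leftarrow\cdots\xleftarrow{\,d_n\,}F_n$$ be a $G$-equivariant minimal complex of graded free $A$-modules of finite rank, with all $d_k\neq 0$. That is, the differentials have degree $0$ and satisfy $d_k(F_k)\subseteq\mathfrak mF_{k-1}$, the group $G$ acts on each $F_k$ by degree-preserving additive maps with $g(af)=g(a)g(f)$ for $a\in A$, $f\in F_k$, and the $d_k$ commute with $G$. Write $d_k|_x$ for the matrix of $d_k$ evaluated at $x\in\mathbb C^N$. Call $F_\bullet$ exact if $0\to F_n\to\cdots\to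 F_1\to F_0$ is exact at $F_1,\dots,F_n$. Call the dual $F_\bullet^*=\operatorname{Hom}_A(F_\bullet,A)$ exact if $0\to F_0^*\to F_1^*\to\cdots\to F_n^*$ is exact at $F_0^*,\dots,F_{n-1}^*$. Suppose there is $j_0\in\{0,\dots,t\}$ such that, whenever $\operatorname{rank}(d_k|_{p_j})<\operatorname{rank}(d_k|_p)$ for some $k\in\{1,\dots,n\}$ and some $j$, we have - $\operatorname{rank}(d_k|_{p_{j_0}})<\operatorname{rank}(d_k|_p)$, and - $\operatorname{codim}(\overline{\mathcal O}_{j_0})\le\operatorname{codim}(\overline{\mathcal O}_j)$. Then: 1. Assume $\sum_{k=0}^n(-1)^k\operatorname{rank}F_k=0$ (as is the case when $F_\bullet$ has the ranks of a free resolution of a torsion module, such as the coordinate ring of a proper orbit closure or its normalization). Then $F_\bullet$ is exact if and only if $F_\bullet^*$ is exact. Moreover, if $F_\bullet$ is exact, then the module $\operatorname{coker}d_1$ that it resolves is perfect, i.e. its projective dimension equals its grade (the length of a longest $A$-regular sequence in its annihilator). 2. If $F_\bullet$ is exact and $\operatorname{coker}d_1\cong\mathbb C[\overline{\mathcal O}_j]$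 as $A$-modules for some $j$, then $\overline{\mathcal O}_j$ is Cohen–Macaulay, i.e. $\mathbb C[\overline{\mathcal O}_j]$ is a Cohen–Macaulay ring. -/

import Mathlib

noncomputable section

namespace OrbitComplex

/-- The polynomial ring `A = ℂ[x₁, …, x_N]`, the coordinate ring of affine space `ℂ^N`. -/
abbrev Poly (N : ℕ) : Type := MvPolynomial (Fin N) ℂ

/-! ### Orbits, Zariski closures, codimension -/

/-- The orbit of the point `x` under the linear action `ρ` of `G` on `ℂ^N`. -/
def orbit {N : ℕ} {G : Type*} [Group G] (ρ : Representation ℂ G (Fin N → ℂ))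
    (x : Fin N → ℂ) : Set (Fin N → ℂ) :=
  Set.range fun g : G => ρ g x

/-- The Zariski closure of a subset of `ℂ^N`. -/
def zariskiClosure {N : ℕ} (S : Set (Fin N → ℂ)) : Set (Fin N → ℂ) :=
  MvPolynomial.zeroLocus ℂ (MvPolynomial.vanishingIdeal ℂ S)

/-- The closure of the orbit of `x`. -/
def orbitClosure {N : ℕ} {G : Type*} [Group G] (ρ : Representation ℂ G (Fin N → ℂ))
    (x : Fin N → ℂ) : Set (Fin N → ℂ) :=
  zariskiClosure (orbit ρ x)

/-- The codimension in `ℂ^N` of a Zariski closed subset: the height of its ideal, that is, the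
smallest height of a minimal prime of the ideal. -/
def codim {N : ℕ} (Z : Set (Fin N → ℂ)) : ℕ∞ :=
  (MvPolynomial.vanishingIdeal ℂ Z).height

/-- The coordinate ring `ℂ[Z] = A / I(Z)` of a Zariski closed subset `Z` of `ℂ^N`. -/
abbrev CoordRing {N : ℕ} (Z : Set (Fin N → ℂ)) : Type :=
  Poly N ⧸ MvPolynomial.vanishingIdeal ℂ Z

/-! ### The induced action on polynomials -/

/-- The action of `g` on polynomial functions, `(g • f)(x) = f(g⁻¹ x)`. -/
def polyAction {N : ℕ} {G : Type*} [Group G] (ρ : Representation ℂ G (Fin N → ℂ)) (g : G) :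
    Poly N →ₐ[ℂ] Poly N :=
  MvPolynomial.aeval fun i : Fin N =>
    ∑ j : Fin N, MvPolynomial.C (ρ g⁻¹ (Pi.single j 1) i) * MvPolynomial.X j

theorem eval_polyAction {N : ℕ} {G : Type*} [Group G] (ρ : Representation ℂ G (Fin N → ℂ))
    (g : G) (f : Poly N) (x : Fin N → ℂ) :
    MvPolynomial.eval x (polyAction ρ g f) = MvPolynomial.eval (ρ g⁻¹ x) f := by
  have hx : ∀ i : Fin N, ρ g⁻¹ x i = ∑ j : Fin N, ρ g⁻¹ (Pi.single j 1) i * x j := by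
    intro i
    have h : x = ∑ j : Fin N, x j • (Pi.single j (1 : ℂ) : Fin N → ℂ) := by
      ext l
      simp [Finset.sum_apply, Pi.single_apply]
    conv_lhs => rw [h]
    simp only [map_sum, map_smul, Finset.sum_apply, Pi.smul_apply, smul_eq_mul]
    exact Finset.sum_congr rfl fun j _ => mul_comm _ _
  induction f using MvPolynomial.induction_on with
  | C a => simp [polyAction]
  | add p q hp hq => simp [hp, hq]
  | mul_X p i hp =>
    rw [map_mul, map_mul, map_mul, hp, MvPolynomial.eval_X, hx i]
    simp [polyAction]

/-! ### Graded free complexes -/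

/-- The polynomial `p` is homogeneous of degree `m ∈ ℤ` (in particular `p = 0` if `m < 0`). -/
def HomogDeg {N : ℕ} (p : Poly N) (m : ℤ) : Prop :=
  ∀ s : Fin N →₀ ℕ, MvPolynomial.coeff s p ≠ 0 → (s.degree : ℤ) = m

/-- A complex `F₀ ← F₁ ← ⋯ ← F_n` of graded free modules of finite rank over `A`, with
differentials of degree `0`. Here `F_k = ⨁ᵢ A(-deg k i)`, and `d k` is the matrix of the
differential `d_{k+1} : F_{k+1} → F_k` in the given homogeneous bases. The modules are indexed
by all natural numbers, and are zero beyond `n`. -/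
structure GradedFreeComplex (N n : ℕ) where
  rank : ℕ → ℕ
  deg : (k : ℕ) → Fin (rank k) → ℤ
  d : (k : ℕ) → Matrix (Fin (rank k)) (Fin (rank (k + 1))) (Poly N)
  rank_eq_zero : ∀ k, n < k → rank k = 0
  d_homog : ∀ k i j, HomogDeg (d k i j) (deg (k + 1) j - deg k i)
  d_comp : ∀ k, d k * d (k + 1) = 0

namespace GradedFreeComplex

variable {N n : ℕ} (F : GradedFreeComplex N n)

/-- The free module `F_k`. -/
abbrev Mod (k : ℕ) : Type := Fin (F.rank k) → Poly N

/-- The differential `d_{k+1} : F_{k+1} → F_k` as a linear map. -/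
def diff (k : ℕ) : F.Mod (k + 1) →ₗ[Poly N] F.Mod k := (F.d k).mulVecLin

/-- Minimality: the image of each differential lies in `𝔪 F_k`, with `𝔪 = (x₁, …, x_N)`, i.e.
the entries of the matrices have zero constant term. -/
def IsMinimal : Prop :=
  ∀ k i j, MvPolynomial.constantCoeff (F.d k i j) = 0

/-- The rank of the differential `d_{k+1}` at the point `x`: the rank of the complex matrix
obtained by evaluating the entries at `x`. -/
def rankAt (k : ℕ) (x : Fin N → ℂ) : ℕ :=
  ((F.d k).map (MvPolynomial.eval x)).rank

/-- `0 → F_n → ⋯ → F₁ → F₀` is exact, i.e. it has zero homology at `F_k` for all `k ≥ 1`. -/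
def IsExact : Prop :=
  ∀ k, Function.Exact (F.diff (k + 1)) (F.diff k)

/-- The dual complex `0 → F₀^* → F₁^* → ⋯ → F_n^*`, with `F_k^* = Hom_A(F_k, A)` and the
transposed differentials, is exact, i.e. it has zero homology at `F_k^*` for all `k < n`. -/
def DualIsExact : Prop :=
  (0 < n → Function.Injective (F.diff 0).dualMap) ∧
    ∀ k, k + 1 < n → Function.Exact (F.diff k).dualMap (F.diff (k + 1)).dualMap

/-- The module `coker d₁ = H₀(F)`, which `F` resolves when it is exact. -/
abbrev Coker : Type := F.Mod 0 ⧸ LinearMap.range (F.diff 0)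

/-- The element `f` of `F_k` is homogeneous of degree `m`. -/
def HomogElem (k : ℕ) (f : F.Mod k) (m : ℤ) : Prop :=
  ∀ i, HomogDeg (f i) (m - F.deg k i)

end GradedFreeComplex

/-- A `G`-equivariant structure on `F`: an action of `G` on each graded free module `F_k`
by degree preserving additive maps, compatible with the action of `G` on `A`, and such that the
differentials are equivariant. -/
structure EquivariantStructure {N n : ℕ} {G : Type*} [Group G]
    (ρ : Representation ℂ G (Fin N → ℂ)) (F : GradedFreeComplex N n) where
  act : (k : ℕ) → G →* AddMonoid.End (F.Mod k)
  act_smul : ∀ k g (a : Poly N) (f : F.Mod k), act k g (a • f) = polyAction ρ g a • act k g f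
  act_homog : ∀ k g (f : F.Mod k) (m : ℤ), F.HomogElem k f m → F.HomogElem k (act k g f) m
  act_diff : ∀ k g (f : F.Mod (k + 1)), act k g (F.diff k f) = F.diff k (act (k + 1) g f)

/-! ### Grade, perfect modules, Cohen–Macaulay rings -/

/-- The depth of an ideal `I` of `R` (on `R`): the supremum of the lengths of the `R`-regular
sequences contained in `I`. -/
def depthIdeal {R : Type*} [CommRing R] (I : Ideal R) : ℕ∞ :=
  ⨆ (rs : List R) (_ : (∀ r ∈ rs, r ∈ I) ∧ RingTheory.Sequence.IsRegular R rs),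
    (rs.length : ℕ∞)

/-- A finitely generated module `M` is perfect if its grade, the depth of its
annihilator, equals its projective dimension. (The zero module, of projective dimension `⊥`, is
not counted as perfect.) -/
def IsPerfectModule (R : Type) [CommRing R] (M : Type) [AddCommGroup M] [Module R M] : Prop :=
  Module.Finite R M ∧
    CategoryTheory.projectiveDimension (ModuleCat.of R M) =
      ((depthIdeal (Module.annihilator R M) : ℕ∞) : WithBot ℕ∞)

/-- A Noetherian ring is Cohen–Macaulay if for each of its localizations at prime
ideals the depth equals the Krull dimension. -/
def IsCohenMacaulayRing (R : Type*) [CommRing R] : Prop :=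
  IsNoetherianRing R ∧ ∀ (P : Ideal R) [P.IsPrime],
    ((depthIdeal (IsLocalRing.maximalIdeal (Localization.AtPrime P)) : ℕ∞) : WithBot ℕ∞) =
      ringKrullDim (Localization.AtPrime P)

end OrbitComplex

end

/-! The engine is a weak form of the Buchsbaum–Eisenbud criterion for a complex 0 → A^{q 0} → ⋯ →
A^{q n}. If it is exact before its last module, consecutive generic ranks are complementary and the
first map drops rank only at primes of height at least n (`IsExactComplex.le_height`). Conversely,
complementary generic ranks and the bound height ≥ n wherever any of the maps drops rank imply
exactness (`isExactComplex_of_forall_le_height`).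

The group closes the gap between "the first map" and "every map". Ranks are constant along orbits,
so each degeneracy locus is a finite union of orbit closures. By minimality every differential
vanishes at the origin, hence degenerates somewhere, and the hypothesis then puts the orbit of `p
j₀` in every degeneracy locus with least codimension. A bound for one differential thus becomes a
bound for all (`le_height_of_forall_le_height`). Transposition preserves ranks, so the criterion
passes between F and its dual. The only missing input is full generic rank at the opposite end: the
alternating sum of ranks supplies it in part 1, a non-zero polynomial killing the cokernel in part
2.

When F and its dual are both exact, Ext^i(coker d₁, A) vanishes for i < n, and minimality keeps
Ext^n non-zero. Rees' theorem then gives grade n, which is also the projective dimension. For A/I,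
shifting Ext along the localized resolution gives depth at least h - n at a prime of height h, while
a regular sequence of length n in I bounds the dimension by h - n. -/

namespace Matrix

/-! ### Ranks of matrices and their behaviour under specialization -/

variable {K : Type*} [Field K]

theorem le_rank_of_submatrix_det_ne_zero {m n : Type*} [Fintype n] {r : ℕ} (M : Matrix m n K) (f : Fin r → m)
    (g : Fin r → n) (h : (M.submatrix f g).det ≠ 0) : r ≤ M.rank := by
  have h1 : (M.submatrix f g).rank = r := by
    rw [rank_of_isUnit _ ((isUnit_iff_isUnit_det _).2 (isUnit_iff_ne_zero.2 h)), Fintype.card_fin]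
  exact h1 ▸ M.rank_submatrix_le f g

variable {m n : Type*} [Fintype m] [Fintype n]

/-- A matrix over a field has linearly independent rows, as many as its rank. -/
theorem exists_linearIndependent_rows (M : Matrix m n K) {r : ℕ} (hr : M.rank = r) :
    ∃ f : Fin r → m, LinearIndependent K fun i => M.row (f i) := by
  subst hr
  rw [M.rank_eq_finrank_span_row]
  obtain ⟨v, hv, -, hli⟩ := Submodule.exists_fun_fin_finrank_span_eq K (Set.range M.row)
  choose f hf using hv
  exact ⟨f, by simpa only [hf] using hli⟩

/-- Rank is thereby detected by minors. Minors commute with ring homomorphisms, which is what allows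
ranks over different residue fields to be compared. -/
theorem exists_submatrix_det_ne_zero (M : Matrix m n K) :
    ∃ (f : Fin M.rank → m) (g : Fin M.rank → n), (M.submatrix f g).det ≠ 0 := by
  obtain ⟨f, hf⟩ := M.exists_linearIndependent_rows rfl
  have h1 : (M.submatrix f id).rank = M.rank := by
    rw [LinearIndependent.rank_matrix (M := M.submatrix f id) hf, Fintype.card_fin]
  obtain ⟨g, hg⟩ := (M.submatrix f id)ᵀ.exists_linearIndependent_rows
    ((rank_transpose _).trans h1)
  refine ⟨f, g, ?_⟩
  have h2 : IsUnit (M.submatrix f g)ᵀ := linearIndependent_rows_iff_isUnit.1 hg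
  rw [isUnit_iff_isUnit_det, det_transpose] at h2
  exact h2.ne_zero

/-- The rank of a specialization of a matrix drops under further specialization. -/
theorem rank_map_le_rank_map_of_ker_le {A L : Type*} [CommRing A] [Field L] (M : Matrix m n A)
    (φ : A →+* K) (ψ : A →+* L) (h : RingHom.ker φ ≤ RingHom.ker ψ) :
    (M.map ψ).rank ≤ (M.map φ).rank := by
  obtain ⟨f, g, hfg⟩ := (M.map ψ).exists_submatrix_det_ne_zero
  refine le_rank_of_submatrix_det_ne_zero _ f g fun h0 => hfg ?_
  have e1 : (M.map ψ).submatrix f g = (M.submatrix f g).map ψ := rfl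
  have e2 : (M.map φ).submatrix f g = (M.submatrix f g).map φ := rfl
  rw [e2, ← RingHom.mapMatrix_apply, ← RingHom.map_det] at h0
  rw [e1, ← RingHom.mapMatrix_apply, ← RingHom.map_det]
  exact h h0

/-- The rank of a matrix over the residue field at `ker φ` is attained at some point `ψ s` of any
family whose common vanishing ideal is contained in `ker φ`. -/
theorem exists_rank_map_le_rank_map {A L ι : Type*} [CommRing A] [Field L] (M : Matrix m n A)
    (φ : A →+* K) (ψ : ι → A →+* L) (h : ∀ a, (∀ s, ψ s a = 0) → φ a = 0) :
    ∃ s, (M.map φ).rank ≤ (M.map (ψ s)).rank := by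
  obtain ⟨f, g, hfg⟩ := (M.map φ).exists_submatrix_det_ne_zero
  have e1 : (M.map φ).submatrix f g = (M.submatrix f g).map φ := rfl
  rw [e1, ← RingHom.mapMatrix_apply, ← RingHom.map_det] at hfg
  obtain ⟨s, hs⟩ := not_forall.1 fun h' => hfg (h _ h')
  refine ⟨s, le_rank_of_submatrix_det_ne_zero _ f g ?_⟩
  have e2 : (M.map (ψ s)).submatrix f g = (M.submatrix f g).map (ψ s) := rfl
  rwa [e2, ← RingHom.mapMatrix_apply, ← RingHom.map_det]

end Matrix

/-! ### Regular sequences of maximal length in regular local rings -/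

section RegularLocalRing

open IsLocalRing RingTheory.Sequence Pointwise

/-- A Noetherian local ring with principal prime ideal `(x)` of positive height is a domain. -/
theorem IsLocalRing.isDomain_of_isPrime_span_singleton {R : Type*} [CommRing R] [IsLocalRing R]
    [IsNoetherianRing R] {x : R} (hx : x ∈ maximalIdeal R) (hxp : (Ideal.span {x}).IsPrime)
    (hmin : ∀ q ∈ minimalPrimes R, x ∉ q) : IsDomain R := by
  obtain ⟨q, hq, hqx⟩ := Ideal.exists_minimalPrimes_le (J := Ideal.span {x}) (bot_le (a := _))
  have hqp : q.IsPrime := hq.1.1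
  -- An element a * x of q has a ∈ q because x ∉ q. Nakayama then forces q = 0.
  have h : q ≤ Ideal.span {x} * q := by
    intro y hy
    obtain ⟨a, rfl⟩ := Ideal.mem_span_singleton'.1 (hqx hy)
    have ha := (hqp.mem_or_mem hy).resolve_right (hmin q hq)
    rw [mul_comm a x]
    exact Ideal.mul_mem_mul (Ideal.mem_span_singleton_self x) ha
  have h0 : q = ⊥ := by
    refine Submodule.eq_bot_of_le_smul_of_le_jacobson_bot (Ideal.span {x}) q
      (IsNoetherian.noetherian q) h ?_
    rw [IsLocalRing.jacobson_eq_maximalIdeal _ bot_ne_top]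
    exact (Ideal.span_singleton_le_iff_mem _).2 hx
  subst h0
  exact IsDomain.of_bot_isPrime R

/-- Induction on the dimension, cutting by an element x of the maximal ideal outside its square and
outside all minimal primes. Being a domain is part of the induction: it makes (x) prime, hence R a
domain, hence x regular. -/
theorem IsLocalRing.isDomain_and_exists_isRegular (d : ℕ) (R : Type*) [CommRing R] [IsLocalRing R]
    [IsNoetherianRing R] (a : Fin d → R) (ha : Ideal.span (Set.range a) = maximalIdeal R)
    (hd : ringKrullDim R = d) :
    IsDomain R ∧ ∃ rs : List R, rs.length = d ∧ (∀ r ∈ rs, r ∈ maximalIdeal R) ∧ IsRegular R rs := by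
  induction d generalizing R with
  | zero =>
    have h0 : maximalIdeal R = ⊥ := by rw [← ha]; simp
    have : IsField R := (IsLocalRing.isField_iff_maximalIdeal_eq).2 h0
    exact ⟨this.isDomain, [], rfl, by simp, IsRegular.nil R R⟩
  | succ d ih =>
    have hm0 : ¬ maximalIdeal R ≤ maximalIdeal R ^ 2 := by
      intro h
      have h0 : maximalIdeal R = ⊥ := by
        refine Submodule.eq_bot_of_le_smul_of_le_jacobson_bot (maximalIdeal R) _
          (IsNoetherian.noetherian _) (by rwa [smul_eq_mul, ← sq]) ?_
        rw [IsLocalRing.jacobson_eq_maximalIdeal _ bot_ne_top]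
      have hf : IsField R := (IsLocalRing.isField_iff_maximalIdeal_eq).2 h0
      rw [ringKrullDim_eq_zero_of_isField hf] at hd
      norm_cast at hd
    have hmin : ∀ q ∈ minimalPrimes R, ¬ maximalIdeal R ≤ q := by
      intro q hq h
      have hqp : q.IsPrime := hq.1.1
      have h1 : q = maximalIdeal R := le_antisymm (IsLocalRing.le_maximalIdeal hqp.ne_top) h
      have h2 := Ideal.height_eq_zero_iff.2 hq
      rw [h1] at h2
      rw [← IsLocalRing.maximalIdeal_height_eq_ringKrullDim, h2] at hd
      norm_cast at hd
    obtain ⟨x, hx, hx2, hxmin⟩ : ∃ x ∈ maximalIdeal R, x ∉ maximalIdeal R ^ 2 ∧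
        ∀ q ∈ minimalPrimes R, x ∉ q := by
      by_contra! hcon
      have hfin := minimalPrimes.finite_of_isNoetherianRing R
      -- Prime avoidance tolerates two ideals that need not be prime; the square of the maximal
      -- ideal fills both exceptional slots.
      have := (Ideal.subset_union_prime_finite (I := maximalIdeal R)
        (hfin.insert (maximalIdeal R ^ 2)) (f := id)
        (maximalIdeal R ^ 2) (maximalIdeal R ^ 2) (by
          intro i hi h1 _
          exact ((Set.mem_insert_iff.1 hi).resolve_left h1).1.1)).1 (by
          intro y hy
          by_cases hy2 : y ∈ maximalIdeal R ^ 2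
          · exact Set.mem_biUnion (Set.mem_insert _ _) hy2
          · obtain ⟨q, hq, hyq⟩ := hcon y hy hy2
            exact Set.mem_biUnion (Set.mem_insert_of_mem _ hq) hyq)
      obtain ⟨q, hq, hle⟩ := this
      rcases Set.mem_insert_iff.1 hq with rfl | hq
      · exact hm0 hle
      · exact hmin q hq hle
    obtain ⟨c, hc⟩ : ∃ c : Fin (d + 1) → R, ∑ i, c i • a i = x := by
      rw [← ha] at hx
      exact (Submodule.mem_span_range_iff_exists_fun R).1 hx
    -- Since x is not in the square, some coefficient is a unit; modulo x the generator `a i`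
    -- becomes redundant.
    obtain ⟨i, hi⟩ : ∃ i, IsUnit (c i) := by
      by_contra! hcon
      refine hx2 ?_
      rw [← hc, sq]
      refine Ideal.sum_mem _ fun i _ => Ideal.mul_mem_mul ((mem_maximalIdeal _).2 (hcon i)) ?_
      rw [← ha]
      exact Ideal.subset_span ⟨i, rfl⟩
    have hxne : Ideal.span {x} ≠ ⊤ := fun h =>
      (maximalIdeal.isMaximal R).ne_top (top_le_iff.1 (h ▸ (Ideal.span_singleton_le_iff_mem _).2 hx))
    have : Nontrivial (R ⧸ Ideal.span {x}) := Ideal.Quotient.nontrivial_iff.2 hxne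
    have : IsLocalRing (R ⧸ Ideal.span {x}) :=
      IsLocalRing.of_surjective' (Ideal.Quotient.mk _) Ideal.Quotient.mk_surjective
    have hmap : (maximalIdeal R).map (Ideal.Quotient.mk (Ideal.span {x})) =
        maximalIdeal (R ⧸ Ideal.span {x}) :=
      map_maximalIdeal_of_surjective _ Ideal.Quotient.mk_surjective
    have hspan : Ideal.span (Set.range fun j => Ideal.Quotient.mk (Ideal.span {x})
        (a (i.succAbove j))) = maximalIdeal (R ⧸ Ideal.span {x}) := by
      rw [← hmap]
      apply le_antisymm
      · rw [Ideal.span_le]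
        rintro _ ⟨j, rfl⟩
        refine Ideal.mem_map_of_mem _ ?_
        rw [← ha]
        exact Ideal.subset_span ⟨_, rfl⟩
      · rw [← ha, Ideal.map_span, Ideal.span_le]
        rintro _ ⟨_, ⟨j, rfl⟩, rfl⟩
        induction j using Fin.succAboveCases i with
        | x =>
          have h0 := congrArg (Ideal.Quotient.mk (Ideal.span {x})) hc
          rw [Ideal.Quotient.eq_zero_iff_mem.2 (Ideal.mem_span_singleton_self x),
            Fin.sum_univ_succAbove _ i, map_add, map_sum, smul_eq_mul, map_mul] at h0
          have hu : IsUnit (Ideal.Quotient.mk (Ideal.span {x}) (c i)) := hi.map _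
          rw [SetLike.mem_coe, ← Ideal.unit_mul_mem_iff_mem _ hu, eq_neg_of_add_eq_zero_left h0]
          refine neg_mem (sum_mem fun j _ => ?_)
          rw [smul_eq_mul, map_mul]
          exact Ideal.mul_mem_left _ _ (Ideal.subset_span ⟨j, rfl⟩)
        | p j => exact Ideal.subset_span ⟨j, rfl⟩
    have hdim : ringKrullDim (R ⧸ Ideal.span {x}) = d := by
      apply le_antisymm
      · refine (ringKrullDim_le_spanFinrank_maximalIdeal _).trans ?_
        rw [← hspan]
        norm_cast
        refine (Submodule.spanFinrank_span_le_ncard_of_finite (Set.finite_range _)).trans ?_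
        rw [← Set.image_univ]
        refine (Set.ncard_image_le Set.finite_univ).trans ?_
        simp [Set.ncard_univ]
      · have h := ringKrullDim_le_ringKrullDim_quotient_add_card {x} (R := R) (by
          rw [IsLocalRing.ringJacobson_eq_maximalIdeal]
          simpa using hx)
        rw [hd, Finset.coe_singleton, Finset.card_singleton, Nat.cast_add] at h
        exact ENat.WithBot.add_le_add_natCast_right_iff.1 h
    obtain ⟨hdom, rs, hlen, hmem, hreg⟩ := ih _ _ hspan hdim
    have hdomR : IsDomain R := IsLocalRing.isDomain_of_isPrime_span_singleton hx
      ((Ideal.Quotient.isDomain_iff_prime _).1 hdom) hxmin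
    have hx0 : x ≠ 0 := by rintro rfl; exact hx2 (zero_mem _)
    obtain ⟨ss, rfl⟩ : ∃ ss : List R, ss.map (algebraMap R (R ⧸ Ideal.span {x})) = rs :=
      List.map_surjective_iff.2 Ideal.Quotient.mk_surjective rs
    have hxss : ∀ r ∈ x :: ss, r ∈ maximalIdeal R := by
      intro r hr
      rcases List.mem_cons.1 hr with rfl | hr
      · exact hx
      · by_contra hcon
        have hu : IsUnit r := by simpa using hcon
        exact (mem_maximalIdeal _).1 (hmem _ (List.mem_map_of_mem hr)) (hu.map _)
    refine ⟨hdomR, x :: ss, by simpa using hlen, hxss, ?_⟩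
    refine (IsLocalRing.isRegular_iff_isWeaklyRegular_of_subset_maximalIdeal hxss).2 ?_
    rw [isWeaklyRegular_cons_iff]
    refine ⟨fun y z h => mul_left_cancel₀ hx0 h, ?_⟩
    have h1 := (isWeaklyRegular_map_algebraMap_iff (R ⧸ Ideal.span {x}) (R ⧸ Ideal.span {x}) ss).1
      hreg.toIsWeaklyRegular
    refine (LinearEquiv.isWeaklyRegular_congr (Submodule.quotEquivOfEq _ _ ?_) ss).1 h1
    rw [← Submodule.ideal_span_singleton_smul, smul_eq_mul, Ideal.mul_top]

/-- The maximal ideal of a regular local ring contains a regular sequence whose length is the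
dimension. -/
theorem IsRegularLocalRing.exists_isRegular (R : Type*) [CommRing R] [IsRegularLocalRing R] :
    ∃ rs : List R, (rs.length : WithBot ℕ∞) = ringKrullDim R ∧
      (∀ r ∈ rs, r ∈ maximalIdeal R) ∧ IsRegular R rs := by
  have hreg := IsRegularLocalRing.spanFinrank_maximalIdeal (R := R)
  have hfg := (maximalIdeal R).fg_of_isNoetherianRing
  have hfin := Submodule.FG.finite_generators hfg
  have hcard : (maximalIdeal R).generators.ncard = (maximalIdeal R).spanFinrank :=
    Submodule.FG.generators_ncard hfg
  have := hfin.fintype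
  rw [← Nat.card_coe_set_eq, Nat.card_eq_fintype_card] at hcard
  obtain ⟨-, rs, hlen, h⟩ := IsLocalRing.isDomain_and_exists_isRegular _ R
    (fun i => (((Fintype.equivFinOfCardEq hcard).symm i : (maximalIdeal R).generators) : R))
    (by
      have h1 := (maximalIdeal R).span_generators
      convert h1 using 2
      rw [← Function.comp_def, EquivLike.range_comp, Subtype.range_coe]) hreg.symm
  exact ⟨rs, by rw [hlen, hreg], h⟩

end RegularLocalRing

/-! ### Ext groups, dimension shifting along free complexes, and depth -/

section ExtOfModules

open CategoryTheory Abelian IsLocalRing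

universe u

variable {R : Type u} [CommRing R]

/-- The group `Ext^i_R(T, M)` of two modules. -/
abbrev ExtMod (R : Type u) [CommRing R] (T M : Type u) [AddCommGroup T] [Module R T]
    [AddCommGroup M] [Module R M] (i : ℕ) : Type u :=
  Ext (ModuleCat.of R T) (ModuleCat.of R M) i

namespace ExtMod

variable (T : Type u) [AddCommGroup T] [Module R T]
variable {M N L : Type u} [AddCommGroup M] [Module R M] [AddCommGroup N] [Module R N]
  [AddCommGroup L] [Module R L]

/-- Functoriality of `Ext^i_R(T, M)` in `M`. -/
noncomputable def map (f : M →ₗ[R] N) (i : ℕ) (x : ExtMod R T M i) : ExtMod R T N i :=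
  x.comp (Ext.mk₀ (ModuleCat.ofHom f)) (add_zero i)

variable {T}

theorem map_id (i : ℕ) (x : ExtMod R T M i) : map T LinearMap.id i x = x := by
  unfold map
  exact Ext.comp_mk₀_id x

theorem map_comp (f : M →ₗ[R] N) (g : N →ₗ[R] L) (i : ℕ) (x : ExtMod R T M i) :
    map T (g ∘ₗ f) i x = map T g i (map T f i x) := by
  unfold map
  rw [Ext.comp_assoc_of_second_deg_zero x, Ext.mk₀_comp_mk₀, ModuleCat.ofHom_comp]

theorem map_zero_right (f : M →ₗ[R] N) (i : ℕ) : map T f i 0 = 0 := by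
  unfold map
  rw [Ext.zero_comp]

theorem map_sum {ι : Type*} [Fintype ι] (f : ι → (M →ₗ[R] N)) (i : ℕ) (x : ExtMod R T M i) :
    map T (∑ a, f a) i x = ∑ a, map T (f a) i x := by
  unfold map
  rw [← Ext.comp_sum, ← Ext.mk₀_sum]
  congr 2
  ext
  simp

theorem map_smul (r : R) (f : M →ₗ[R] N) (i : ℕ) (x : ExtMod R T M i) :
    map T (r • f) i x = r • map T f i x := by
  unfold map
  rw [← Ext.comp_smul, ← Ext.mk₀_smul]
  rfl

theorem smul_eq_zero {r : R} (hr : r ∈ Module.annihilator R T) (i : ℕ) (x : ExtMod R T M i) :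
    r • x = 0 := by
  have h := Ext.postcomp_smul_id_eq_zero_of_mem_annihilator (M := ModuleCat.of R M)
    (N := ModuleCat.of R T) hr i
  have h2 := ConcreteCategory.congr_hom h x
  simpa [Ext.mk₀_smul] using h2

theorem subsingleton_of_equiv (e : M ≃ₗ[R] N) (i : ℕ) [h : Subsingleton (ExtMod R T M i)] :
    Subsingleton (ExtMod R T N i) := by
  refine subsingleton_of_forall_eq 0 fun x => ?_
  have h1 : map T ((e : M →ₗ[R] N) ∘ₗ (e.symm : N →ₗ[R] M)) i x = x := by
    rw [LinearEquiv.comp_symm, map_id]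
  rw [← h1, map_comp, Subsingleton.elim (map T _ i x) 0, map_zero_right]

theorem subsingleton_zero_iff : Subsingleton (ExtMod R T M 0) ↔ Subsingleton (T →ₗ[R] M) :=
  (Ext.addEquiv₀.trans ModuleCat.homAddEquiv).subsingleton_congr

theorem map_zero_injective {f : M →ₗ[R] N} (hf : Function.Injective f) :
    Function.Injective (map T f 0) := by
  have : Mono (ModuleCat.ofHom f) := (ModuleCat.mono_iff_injective _).2 hf
  exact Ext.postcomp_mk₀_injective_of_mono (ModuleCat.of R T) (ModuleCat.ofHom f)

section Exact

variable {f : M →ₗ[R] N} {g : N →ₗ[R] L}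

theorem shortExact (hf : Function.Injective f) (hfg : Function.Exact f g)
    (hg : Function.Surjective g) :
    (ModuleCat.shortComplexOfCompEqZero f g hfg.linearMap_comp_eq_zero).ShortExact :=
  ModuleCat.shortComplex_shortExact _ hfg hf hg

theorem subsingleton_right (hf : Function.Injective f) (hfg : Function.Exact f g)
    (hg : Function.Surjective g) (i : ℕ) (h2 : Subsingleton (ExtMod R T N i))
    (h1 : Subsingleton (ExtMod R T M (i + 1))) : Subsingleton (ExtMod R T L i) := by
  refine subsingleton_of_forall_eq 0 fun x => ?_
  obtain ⟨y, rfl⟩ := Ext.covariant_sequence_exact₃ (ModuleCat.of R T) (shortExact hf hfg hg) x rfl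
    (h1.elim _ _)
  rw [h2.elim y 0, Ext.zero_comp]

theorem map_succ_injective (hf : Function.Injective f) (hfg : Function.Exact f g)
    (hg : Function.Surjective g) (i : ℕ) (h3 : Subsingleton (ExtMod R T L i)) :
    Function.Injective (map T f (i + 1)) := by
  have key : ∀ x : ExtMod R T M (i + 1), map T f (i + 1) x = 0 → x = 0 := by
    intro x hx
    obtain ⟨y, rfl⟩ := Ext.covariant_sequence_exact₁ (ModuleCat.of R T) (shortExact hf hfg hg) x
      hx rfl
    rw [h3.elim y 0, Ext.zero_comp]
  intro x y hxy
  rw [← sub_eq_zero]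
  refine key _ ?_
  unfold map at hxy ⊢
  rw [sub_eq_add_neg, Ext.add_comp, Ext.neg_comp, hxy, add_neg_cancel]

theorem subsingleton_left (hf : Function.Injective f) (hfg : Function.Exact f g)
    (hg : Function.Surjective g) (i : ℕ) (h3 : Subsingleton (ExtMod R T L i))
    (h2 : Subsingleton (ExtMod R T N (i + 1))) : Subsingleton (ExtMod R T M (i + 1)) :=
  (map_succ_injective hf hfg hg i h3).subsingleton

end Exact

theorem subsingleton_pi (q : ℕ) (i : ℕ) (h : Subsingleton (ExtMod R T R i)) :
    Subsingleton (ExtMod R T (Fin q → R) i) := by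
  refine subsingleton_of_forall_eq 0 fun x => ?_
  have h1 : (LinearMap.id : (Fin q → R) →ₗ[R] (Fin q → R)) =
      ∑ j, LinearMap.single R (fun _ => R) j ∘ₗ LinearMap.proj j := by
    ext a b
    simp [Finset.sum_apply, Pi.single_apply]
  rw [← map_id i x, h1, map_sum]
  refine Finset.sum_eq_zero fun j _ => ?_
  rw [map_comp, h.elim (map T _ i x) 0, map_zero_right]

/-- A map of free modules over a local ring which is not injective modulo the maximal ideal is
not injective on a non zero `Ext` group from a module killed by the maximal ideal. -/
theorem subsingleton_of_map_injective [IsLocalRing R]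
    (hT : maximalIdeal R ≤ Module.annihilator R T) {a b : ℕ}
    {f : (Fin a → R) →ₗ[R] (Fin b → R)} {i : ℕ} (hf : Function.Injective (map T f i))
    (v : Fin a → R) (j : Fin a) (hv : IsUnit (v j)) (hfv : ∀ l, f v l ∈ maximalIdeal R) :
    Subsingleton (ExtMod R T R i) := by
  refine subsingleton_of_forall_eq 0 fun x => ?_
  -- The composite of g with f has coefficients in the maximal ideal, so it acts as zero on Ext,
  -- whereas the j-th coordinate of g is multiplication by a unit.
  let g : R →ₗ[R] (Fin a → R) := LinearMap.toSpanSingleton R _ v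
  have h0 : map T (f ∘ₗ g) i x = 0 := by
    have h1 : f ∘ₗ g = ∑ l, f v l • LinearMap.single R (fun _ => R) l := by
      ext k
      simp [g, Finset.sum_apply, Pi.single_apply]
    rw [h1, map_sum]
    refine Finset.sum_eq_zero fun l _ => ?_
    rw [map_smul]
    exact smul_eq_zero (hT (hfv l)) _ _
  have h2 : map T g i x = 0 := by
    apply hf
    rw [← map_comp, h0, map_zero_right]
  have h3 : v j • x = 0 := by
    have h4 : (LinearMap.proj j : (Fin a → R) →ₗ[R] R) ∘ₗ g = v j • LinearMap.id := by
      ext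
      simp [g]
    rw [← map_id i x, ← map_smul, ← h4, map_comp, h2, map_zero_right]
  exact (hv.smul_eq_zero).1 h3

/-! ### Complexes of free modules -/

section Complex

variable {q : ℕ → ℕ} {f : ∀ i, (Fin (q i) → R) →ₗ[R] (Fin (q (i + 1)) → R)}

theorem exact_subtype_rangeRestrict {j : ℕ} (h : Function.Exact (f j) (f (j + 1))) :
    Function.Exact (LinearMap.range (f j)).subtype (f (j + 1)).rangeRestrict := by
  intro x
  rw [← LinearMap.mem_ker, LinearMap.ker_rangeRestrict, LinearMap.mem_ker, h x]
  simp

/-- Dimension shifting from the left end of an exact complex. -/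
theorem subsingleton_range {h : ℕ} (hR : ∀ i < h, Subsingleton (ExtMod R T R i))
    (hinj : Function.Injective (f 0)) (j : ℕ) (hex : ∀ i < j, Function.Exact (f i) (f (i + 1)))
    (i : ℕ) (hi : i + j < h) : Subsingleton (ExtMod R T (LinearMap.range (f j)) i) := by
  induction j generalizing i with
  | zero =>
    have := subsingleton_pi (T := T) (q 0) i (hR i hi)
    exact subsingleton_of_equiv (LinearEquiv.ofInjective (f 0) hinj) i
  | succ j ih =>
    exact subsingleton_right (LinearMap.range (f j)).injective_subtype
      (exact_subtype_rangeRestrict (hex j (by omega))) (LinearMap.surjective_rangeRestrict _) i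
      (subsingleton_pi _ _ (hR i (by omega)))
      (ih (fun i hi => hex i (by omega)) (i + 1) (by omega))

/-- Ext^i of the cokernel lies between Ext^i of a free module and Ext^(i+1) of the image, so the
shift costs j + 1 degrees. -/
theorem subsingleton_coker {h : ℕ} (hR : ∀ i < h, Subsingleton (ExtMod R T R i))
    (hinj : Function.Injective (f 0)) (j : ℕ) (hex : ∀ i < j, Function.Exact (f i) (f (i + 1)))
    (i : ℕ) (hi : i + j + 1 < h) :
    Subsingleton (ExtMod R T ((Fin (q (j + 1)) → R) ⧸ LinearMap.range (f j)) i) :=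
  subsingleton_right (LinearMap.range (f j)).injective_subtype
    (LinearMap.exact_subtype_mkQ _) (Submodule.mkQ_surjective _) i
    (subsingleton_pi _ _ (hR i (by omega))) (subsingleton_range hR hinj j hex (i + 1) (by omega))

/-- Dimension shifting from the right end of an exact complex. -/
theorem subsingleton_range_of_exact_right {e : ℕ} (he : ∀ i < e, Subsingleton (ExtMod R T R i))
    (hex : ∀ i < e, Function.Exact (f i) (f (i + 1))) (i j : ℕ) (hj : 1 ≤ j) (hij : i + j = e) :
    Subsingleton (ExtMod R T (LinearMap.range (f j)) i) := by
  induction i generalizing j with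
  | zero =>
    have := subsingleton_pi (T := T) (q (j + 1)) 0 (he 0 (by omega))
    exact (map_zero_injective (LinearMap.range (f j)).injective_subtype).subsingleton
  | succ i ih =>
    exact subsingleton_left (LinearMap.range (f j)).injective_subtype
      (exact_subtype_rangeRestrict (hex j (by omega))) (LinearMap.surjective_rangeRestrict _) i
      (ih (j + 1) (by omega) (by omega)) (subsingleton_pi _ _ (he _ (by omega)))

/-- In positive degree e the kernel comes from Ext^(e-1) of the cokernel of `f 0`, which by
exactness is the image of `f 1`. -/
theorem map_injective_of_exact {e : ℕ} (he : ∀ i < e, Subsingleton (ExtMod R T R i))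
    (hinj : Function.Injective (f 0)) (hex : ∀ i < e, Function.Exact (f i) (f (i + 1))) :
    Function.Injective (map T (f 0) e) := by
  cases e with
  | zero => exact map_zero_injective hinj
  | succ e =>
    refine map_succ_injective (g := (f 1).rangeRestrict) hinj (fun x => ?_)
      (LinearMap.surjective_rangeRestrict _) e
      (subsingleton_range_of_exact_right he hex e 1 le_rfl rfl)
    rw [← LinearMap.mem_ker, LinearMap.ker_rangeRestrict, LinearMap.mem_ker]
    exact hex 0 (by omega) x

end Complex

/-! ### Depth of local rings -/

section Depth

variable [IsLocalRing R]

theorem annihilator_residueField : Module.annihilator R (ResidueField R) = maximalIdeal R :=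
  Ideal.annihilator_quotient

theorem support_residueField :
    Module.support R (ResidueField R) = PrimeSpectrum.zeroLocus (maximalIdeal R) := by
  have : Module.Finite R (ResidueField R) :=
    Module.Finite.of_surjective (Algebra.linearMap R _) residue_surjective
  rw [Module.support_eq_zeroLocus, annihilator_residueField]

theorem smul_top_lt_top [Nontrivial M] [Module.Finite R M] :
    maximalIdeal R • (⊤ : Submodule R M) < ⊤ := by
  refine lt_top_iff_ne_top.2 (Ne.symm ?_)
  exact Submodule.top_ne_ideal_smul_of_le_jacobson_annihilator
    (IsLocalRing.maximalIdeal_le_jacobson _)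

/-- Rees' characterization of depth, tested on the residue field. -/
theorem exists_isRegular [IsNoetherianRing R] [Nontrivial M] [Module.Finite R M] {h : ℕ}
    (hM : ∀ i < h, Subsingleton (ExtMod R (ResidueField R) M i)) :
    ∃ rs : List R, rs.length = h ∧ (∀ r ∈ rs, r ∈ maximalIdeal R) ∧
      RingTheory.Sequence.IsRegular M rs :=
  ModuleCat.exists_isRegular_of_exists_subsingleton_ext (maximalIdeal R) h (ModuleCat.of R M)
    smul_top_lt_top (ModuleCat.of R (ResidueField R)) support_residueField hM

/-- Over a regular local ring of dimension `h`, the groups `Ext^i(k, R)` vanish for `i < h`. -/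
theorem subsingleton_of_isRegularLocalRing (R : Type u) [CommRing R] [IsRegularLocalRing R] {h : ℕ}
    (hh : ringKrullDim R = h) (i : ℕ) (hi : i < h) :
    Subsingleton (ExtMod R (ResidueField R) R i) := by
  obtain ⟨rs, hlen, hmem, hreg⟩ := IsRegularLocalRing.exists_isRegular R
  have hlen' : rs.length = h := by
    rw [hh] at hlen
    exact_mod_cast hlen
  exact ModuleCat.subsingleton_ext_of_exists_isRegular (maximalIdeal R)
    (ModuleCat.of R (ResidueField R)) support_residueField.le (ModuleCat.of R R)
    smul_top_lt_top rs hmem hreg i (by omega)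

/-- If an exact complex of length `n` of free modules over a Noetherian local ring does not start
with a split injection, then `n` is at most the dimension. -/
theorem le_of_exact [IsNoetherianRing R] {q : ℕ → ℕ}
    {f : ∀ i, (Fin (q i) → R) →ₗ[R] (Fin (q (i + 1)) → R)} {n h : ℕ}
    (hinj : Function.Injective (f 0)) (hex : ∀ i, i + 1 < n → Function.Exact (f i) (f (i + 1)))
    (v : Fin (q 0) → R) (j : Fin (q 0)) (hv : IsUnit (v j)) (hfv : ∀ l, f 0 v l ∈ maximalIdeal R)
    (hh : ringKrullDim R = h) : n ≤ h := by
  by_contra! hlt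
  -- Exactness makes Ext^e of `f 0` injective once the lower Ext groups vanish, while v is non-zero
  -- modulo the maximal ideal and dies there. So Ext^e vanishes too, and the depth would exceed the
  -- dimension h.
  have key : ∀ e ≤ h, Subsingleton (ExtMod R (ResidueField R) R e) := by
    intro e
    induction e using Nat.strong_induction_on with
    | _ e ih =>
      intro he
      exact subsingleton_of_map_injective annihilator_residueField.ge
        (map_injective_of_exact (fun i hi => ih i hi (by omega)) hinj
          fun i hi => hex i (by omega)) v j hv hfv
  obtain ⟨rs, hlen, -, hreg⟩ := exists_isRegular (R := R) (M := R) (h := h + 1)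
    fun i hi => key i (by omega)
  have h1 := ringKrullDim_add_length_eq_ringKrullDim_of_isRegular rs hreg
  have h2 : Nontrivial (R ⧸ Ideal.ofList rs) := by
    refine Ideal.Quotient.nontrivial_iff.2 fun h => hreg.top_ne_smul ?_
    rw [h, smul_eq_mul, Ideal.mul_top]
  have h3 := ringKrullDim_nonneg_of_nontrivial (R := R ⧸ Ideal.ofList rs)
  rw [hh, hlen] at h1
  have h4 : ((h + 1 : ℕ) : WithBot ℕ∞) ≤ h := by
    rw [← h1]
    exact le_add_of_nonneg_left h3
  have h5 : h + 1 ≤ h := by exact_mod_cast h4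
  omega

end Depth

end ExtMod

end ExtOfModules

/-! ### Exactness over a local ring read off from residue ranks -/

section LocalExactness

open IsLocalRing

theorem Matrix.map_mulVec_apply {A B m n : Type*} [CommSemiring A] [CommSemiring B] [Fintype n]
    (φ : A →+* B) (M : Matrix m n A) (v : n → A) (i : m) :
    (M.map φ).mulVec (fun j => φ (v j)) i = φ (M.mulVec v i) := by
  rw [RingHom.map_mulVec]
  rfl

theorem Matrix.rank_add_rank_of_exact {K : Type*} [Field K] {a b c : ℕ}
    (M : Matrix (Fin b) (Fin a) K) (N : Matrix (Fin c) (Fin b) K)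
    (h : Function.Exact M.mulVecLin N.mulVecLin) : M.rank + N.rank = b := by
  have h1 := N.mulVecLin.finrank_range_add_finrank_ker
  rw [Module.finrank_fin_fun, LinearMap.exact_iff.1 h] at h1
  unfold Matrix.rank
  omega

theorem Matrix.rank_eq_of_injective {K : Type*} [Field K] {a b : ℕ}
    (M : Matrix (Fin b) (Fin a) K) (h : Function.Injective M.mulVecLin) : M.rank = a := by
  unfold Matrix.rank
  rw [LinearMap.finrank_range_of_inj h, Module.finrank_fin_fun]

theorem Matrix.injective_of_rank_eq {K : Type*} [Field K] {a b : ℕ}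
    (M : Matrix (Fin b) (Fin a) K) (h : M.rank = a) : Function.Injective M.mulVecLin := by
  have h1 := M.mulVecLin.finrank_range_add_finrank_ker
  rw [Module.finrank_fin_fun] at h1
  rw [← LinearMap.ker_eq_bot, ← Submodule.finrank_eq_zero (R := K)]
  unfold Matrix.rank at h
  omega

/-- A complex of free modules over a local ring is exact as soon as the ranks over the residue
field are complementary. -/
theorem IsLocalRing.exact_of_rank_add_rank {R : Type*} [CommRing R] [IsLocalRing R] {a b c : ℕ}
    (M : Matrix (Fin b) (Fin a) R) (N : Matrix (Fin c) (Fin b) R) (h : N * M = 0)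
    (hr : (M.map (residue R)).rank + (N.map (residue R)).rank = b) :
    Function.Exact M.mulVecLin N.mulVecLin := by
  set M' := M.map (residue R)
  set N' := N.map (residue R)
  have h' : N' * M' = 0 := by
    rw [← Matrix.map_mul, h, Matrix.map_zero _ (map_zero _)]
  obtain ⟨f, g, hfg⟩ := N'.exists_submatrix_det_ne_zero
  -- A minor that is non-zero over the residue field is a unit over R, so N is injective on the
  -- coordinate submodule spanned by the columns g.
  have hu : IsUnit (N.submatrix f g).det := by
    by_contra hn
    refine hfg ?_
    have e1 : N'.submatrix f g = (N.submatrix f g).map (residue R) := rfl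
    rw [e1, ← RingHom.mapMatrix_apply, ← RingHom.map_det, residue_eq_zero_iff]
    exact (mem_maximalIdeal _).2 hn
  -- Stated for a general ring because it is needed over the residue field, for the dimension count,
  -- and over R, for the conclusion.
  have hE : ∀ {S : Type _} [CommRing S] (w : Fin N'.rank → S)
      (T : Matrix (Fin c) (Fin b) S), T.mulVec
      (((1 : Matrix (Fin b) (Fin b) S).submatrix id g).mulVec w) = 0 →
      IsUnit (T.submatrix f g).det → w = 0 := by
    intro S _ w T h1 h2
    rw [Matrix.mulVec_mulVec] at h1
    have h3 : (T.submatrix f g).mulVec w = 0 := by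
      ext i
      have := congrFun h1 (f i)
      have e : T * (1 : Matrix (Fin b) (Fin b) S).submatrix id g = T.submatrix id g := by
        ext i j
        simp [Matrix.mul_apply, Matrix.one_apply]
      rw [e] at this
      exact this
    have hinj := Matrix.mulVec_injective_of_isUnit ((Matrix.isUnit_iff_isUnit_det _).2 h2)
    exact hinj (h3.trans (Matrix.mulVec_zero _).symm)
  have hsup : LinearMap.range M'.mulVecLin ⊔
      LinearMap.range ((1 : Matrix (Fin b) (Fin b) (ResidueField R)).submatrix id g).mulVecLin
        = ⊤ := by
    have hdisj : LinearMap.range M'.mulVecLin ⊓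
        LinearMap.range ((1 : Matrix (Fin b) (Fin b) (ResidueField R)).submatrix id g).mulVecLin
          = ⊥ := by
      rw [eq_bot_iff]
      rintro _ ⟨⟨u, rfl⟩, ⟨w, hw⟩⟩
      have h1 := hE w N' (by
        rw [← Matrix.mulVecLin_apply ((1 : Matrix (Fin b) (Fin b) _).submatrix id g), hw,
          Matrix.mulVecLin_apply, Matrix.mulVec_mulVec, h', Matrix.zero_mulVec])
        (isUnit_iff_ne_zero.2 hfg)
      rw [← hw, h1, map_zero]
      exact zero_mem _
    have hinj : Function.Injective
        ((1 : Matrix (Fin b) (Fin b) (ResidueField R)).submatrix id g).mulVecLin := by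
      rw [← LinearMap.ker_eq_bot, eq_bot_iff]
      intro w hw
      refine hE w N' ?_ (isUnit_iff_ne_zero.2 hfg)
      rw [LinearMap.mem_ker, Matrix.mulVecLin_apply] at hw
      rw [hw, Matrix.mulVec_zero]
    have h1 := Submodule.finrank_sup_add_finrank_inf_eq (LinearMap.range M'.mulVecLin)
      (LinearMap.range ((1 : Matrix (Fin b) (Fin b) (ResidueField R)).submatrix id g).mulVecLin)
    rw [hdisj, finrank_bot, add_zero, LinearMap.finrank_range_of_inj hinj, Module.finrank_fin_fun] at h1
    refine Submodule.eq_top_of_finrank_eq ?_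
    rw [Module.finrank_fin_fun]
    exact h1.trans hr
  -- Nakayama lifts the decomposition to R. A cycle y = M u + E w then satisfies N E w = 0, so w = 0
  -- and y is a boundary.
  have hsupR : LinearMap.range M.mulVecLin ⊔
      LinearMap.range ((1 : Matrix (Fin b) (Fin b) R).submatrix id g).mulVecLin = ⊤ := by
    rw [eq_top_iff]
    refine Submodule.le_of_le_smul_of_le_jacobson_bot (I := maximalIdeal R) Module.Finite.fg_top
      (IsLocalRing.jacobson_eq_maximalIdeal _ bot_ne_top).ge ?_
    intro y _
    have hy : (fun i => residue R (y i)) ∈ LinearMap.range M'.mulVecLin ⊔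
      LinearMap.range ((1 : Matrix (Fin b) (Fin b) (ResidueField R)).submatrix id g).mulVecLin := by
      rw [hsup]; trivial
    obtain ⟨_, ⟨u, rfl⟩, _, ⟨w, rfl⟩, huw⟩ := Submodule.mem_sup.1 hy
    choose u' hu' using fun j => residue_surjective (R := R) (u j)
    choose w' hw' using fun j => residue_surjective (R := R) (w j)
    obtain rfl : (fun j => residue R (u' j)) = u := funext hu'
    obtain rfl : (fun j => residue R (w' j)) = w := funext hw'
    have e1 : (1 : Matrix (Fin b) (Fin b) (ResidueField R)).submatrix id g =
        ((1 : Matrix (Fin b) (Fin b) R).submatrix id g).map (residue R) := by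
      ext i j
      simp [Matrix.one_apply, apply_ite]
    refine Submodule.mem_sup.2 ⟨M.mulVec u' + ((1 : Matrix (Fin b) (Fin b) R).submatrix id g).mulVec
      w', Submodule.add_mem_sup ⟨u', rfl⟩ ⟨w', rfl⟩, y - (M.mulVec u' +
        ((1 : Matrix (Fin b) (Fin b) R).submatrix id g).mulVec w'), ?_, by abel⟩
    set z := y - (M.mulVec u' + ((1 : Matrix (Fin b) (Fin b) R).submatrix id g).mulVec w') with hz
    have hz1 : z = ∑ i, z i • Pi.single (M := fun _ => R) i 1 := by
      ext i
      simp [Finset.sum_apply, Pi.single_apply]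
    rw [hz1]
    refine sum_mem fun i _ => Submodule.smul_mem_smul ?_ trivial
    rw [← residue_eq_zero_iff, hz, Pi.sub_apply, Pi.add_apply, map_sub, map_add,
      ← Matrix.map_mulVec_apply, ← Matrix.map_mulVec_apply, ← e1, sub_eq_zero]
    exact (congrFun huw i).symm
  intro y
  constructor
  · intro hy
    have hy' : y ∈ LinearMap.range M.mulVecLin ⊔
      LinearMap.range ((1 : Matrix (Fin b) (Fin b) R).submatrix id g).mulVecLin := by
      rw [hsupR]; trivial
    obtain ⟨_, ⟨u, rfl⟩, _, ⟨w, rfl⟩, rfl⟩ := Submodule.mem_sup.1 hy'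
    rw [map_add, Matrix.mulVecLin_apply, Matrix.mulVecLin_apply, Matrix.mulVec_mulVec, h,
      Matrix.zero_mulVec, zero_add, Matrix.mulVecLin_apply, Matrix.mulVecLin_apply] at hy
    rw [hE w N hy hu, map_zero, add_zero]
    exact ⟨u, rfl⟩
  · rintro ⟨x, rfl⟩
    rw [Matrix.mulVecLin_apply, Matrix.mulVecLin_apply, Matrix.mulVec_mulVec, h,
      Matrix.zero_mulVec]

end LocalExactness

/-! ### Exactness of complexes and heights of the primes where ranks drop -/

section MatrixComplex

open IsLocalRing

universe u

namespace Matrix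

section Localization

variable {A B : Type*} [CommRing A] [CommRing B] [Algebra A B] {S : Submonoid A}

theorem exists_smul_eq_algebraMap (S : Submonoid A) [IsLocalization S B] {m : Type*} [Finite m]
    (y : m → B) : ∃ s ∈ S, ∃ x : m → A, (algebraMap A B s) • y = fun i => algebraMap A B (x i) := by
  obtain ⟨s, hs⟩ := IsLocalization.exist_integer_multiples_of_finite S y
  choose x hx using hs
  refine ⟨s, s.2, x, funext fun i => ?_⟩
  rw [Pi.smul_apply, hx, smul_eq_mul, Algebra.smul_def]

theorem exact_map_of_isLocalization (hS : S ≤ nonZeroDivisors A) [IsLocalization S B]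
    {l m n : Type*} [Fintype l] [Fintype m] [Finite n]
    {M : Matrix m l A} {N : Matrix n m A} (h : Function.Exact M.mulVecLin N.mulVecLin) :
    Function.Exact (M.map (algebraMap A B)).mulVecLin (N.map (algebraMap A B)).mulVecLin := by
  have hinj : Function.Injective (algebraMap A B) := IsLocalization.injective B hS
  intro y
  obtain ⟨s, hs, x, hx⟩ := exists_smul_eq_algebraMap S y
  have hu : IsUnit (algebraMap A B s) := IsLocalization.map_units B ⟨s, hs⟩
  have e1 : ∀ z : m → A, (N.map (algebraMap A B)).mulVec (fun i => algebraMap A B (z i)) =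
      fun i => algebraMap A B (N.mulVec z i) := fun z => funext fun i => map_mulVec_apply _ _ _ _
  have e2 : ∀ z : l → A, (M.map (algebraMap A B)).mulVec (fun i => algebraMap A B (z i)) =
      fun i => algebraMap A B (M.mulVec z i) := fun z => funext fun i => map_mulVec_apply _ _ _ _
  constructor
  · intro hy
    have h1 : (N.map (algebraMap A B)).mulVec (algebraMap A B s • y) = 0 := by
      rw [mulVec_smul, ← mulVecLin_apply, hy, smul_zero]
    rw [hx, e1] at h1
    have h2 : N.mulVecLin x = 0 := funext fun i => hinj (by
      rw [Pi.zero_apply, map_zero]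
      exact congrFun h1 i)
    obtain ⟨z, rfl⟩ := (h x).1 h2
    refine ⟨(↑hu.unit⁻¹ : B) • fun i => algebraMap A B (z i), ?_⟩
    rw [map_smul, mulVecLin_apply, e2, ← mulVecLin_apply, ← hx, smul_smul, IsUnit.val_inv_mul,
      one_smul]
  · rintro ⟨z, rfl⟩
    obtain ⟨t, ht, w, hw⟩ := exists_smul_eq_algebraMap S z
    have hut : IsUnit (algebraMap A B t) := IsLocalization.map_units B ⟨t, ht⟩
    rw [← hut.smul_eq_zero, ← map_smul, ← map_smul, hw, mulVecLin_apply, mulVecLin_apply, e2, e1]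
    funext i
    have := congrFun (h.apply_apply_eq_zero w) i
    rw [mulVecLin_apply, mulVecLin_apply] at this
    rw [this, Pi.zero_apply, map_zero, Pi.zero_apply]

theorem injective_map_of_isLocalization (hS : S ≤ nonZeroDivisors A) [IsLocalization S B]
    {m n : Type*} [Fintype m] [Finite n] {N : Matrix n m A} (h : Function.Injective N.mulVecLin) :
    Function.Injective (N.map (algebraMap A B)).mulVecLin := by
  -- Injectivity is exactness after a map from the zero module, so the previous lemma applies.
  have h0 : Function.Exact (0 : Matrix m (Fin 0) A).mulVecLin N.mulVecLin := by
    rw [LinearMap.exact_iff, LinearMap.ker_eq_bot.2 h, mulVecLin_zero, LinearMap.range_zero]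
  have h1 := exact_map_of_isLocalization (B := B) hS h0
  rw [Matrix.map_zero _ (map_zero _), LinearMap.exact_iff, mulVecLin_zero,
    LinearMap.range_zero] at h1
  exact LinearMap.ker_eq_bot.1 h1

end Localization

variable {A : Type u} [CommRing A]

/-- The rank of a matrix over the residue field at a prime ideal. -/
noncomputable def rankAtPrime {m n : Type*} [Fintype n] (M : Matrix m n A) (P : Ideal A)
    [P.IsPrime] : ℕ :=
  (M.map (algebraMap A P.ResidueField)).rank

theorem map_algebraMap_map_residue {m n : Type*} (M : Matrix m n A) (P : Ideal A) [P.IsPrime] :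
    (M.map (algebraMap A (Localization.AtPrime P))).map (residue (Localization.AtPrime P)) =
      M.map (algebraMap A P.ResidueField) := rfl

/-- The rank of a matrix over the fraction field. -/
noncomputable def genericRank [IsDomain A] {m n : Type*} [Fintype n] (M : Matrix m n A) : ℕ :=
  (M.map (algebraMap A (FractionRing A))).rank

theorem rankAtPrime_le_genericRank [IsDomain A] {m n : Type*} [Fintype m] [Fintype n]
    (M : Matrix m n A) (P : Ideal A) [P.IsPrime] : M.rankAtPrime P ≤ M.genericRank := by
  refine rank_map_le_rank_map_of_ker_le M _ _ ?_
  rw [(RingHom.injective_iff_ker_eq_bot _).1 (IsFractionRing.injective A (FractionRing A))]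
  exact bot_le

/-- The exactness of a complex `0 → A^{q 0} → A^{q 1} → ⋯ → A^{q n}` of free modules, except at
the last module. -/
def IsExactComplex {q : ℕ → ℕ} (n : ℕ) (D : ∀ i, Matrix (Fin (q (i + 1))) (Fin (q i)) A) : Prop :=
  Function.Injective (D 0).mulVecLin ∧
    ∀ i, i + 1 < n → Function.Exact (D i).mulVecLin (D (i + 1)).mulVecLin

variable {q : ℕ → ℕ} {n : ℕ} {D : ∀ i, Matrix (Fin (q (i + 1))) (Fin (q i)) A}

theorem IsExactComplex.map_of_isLocalization [IsDomain A] {S : Submonoid A}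
    (hS : S ≤ nonZeroDivisors A)
    (B : Type*) [CommRing B] [Algebra A B] [IsLocalization S B] (h : IsExactComplex n D) :
    IsExactComplex n fun i => (D i).map (algebraMap A B) :=
  ⟨injective_map_of_isLocalization hS h.1, fun i hi => exact_map_of_isLocalization hS (h.2 i hi)⟩

section IsDomain

variable [IsDomain A]

theorem IsExactComplex.genericRank_zero (h : IsExactComplex n D) : (D 0).genericRank = q 0 :=
  rank_eq_of_injective _ (h.map_of_isLocalization le_rfl (FractionRing A)).1

theorem IsExactComplex.genericRank_add_genericRank (h : IsExactComplex n D) (i : ℕ)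
    (hi : i + 1 < n) : (D i).genericRank + (D (i + 1)).genericRank = q (i + 1) :=
  rank_add_rank_of_exact _ _ ((h.map_of_isLocalization le_rfl (FractionRing A)).2 i hi)

/-- If the rank of the first map of an exact complex drops at a prime ideal, then the height of the
prime ideal is at least the length of the complex. -/
theorem IsExactComplex.le_height [IsNoetherianRing A] (h : IsExactComplex n D) (P : Ideal A)
    [P.IsPrime] (hP : (D 0).rankAtPrime P < (D 0).genericRank) : (n : ℕ∞) ≤ P.height := by
  have hloc := h.map_of_isLocalization P.primeCompl_le_nonZeroDivisors (Localization.AtPrime P)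
  obtain ⟨m, hm⟩ := ENat.ne_top_iff_exists.1 (Ideal.height_ne_top_of_isPrime (I := P))
  have hdim : ringKrullDim (Localization.AtPrime P) = m := by
    rw [IsLocalization.AtPrime.ringKrullDim_eq_height P, ← hm]
    rfl
  rw [← hm]
  norm_cast
  -- The generic rank is the full `q 0`, so a drop yields a kernel vector over the residue field.
  -- Its lift has a unit coordinate and image in the maximal ideal, as `ExtMod.le_of_exact`
  -- requires.
  have hninj : ¬ Function.Injective ((D 0).map (algebraMap A P.ResidueField)).mulVecLin := by
    intro hinj
    have h1 := rank_eq_of_injective _ hinj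
    rw [h.genericRank_zero] at hP
    exact hP.ne h1
  rw [← LinearMap.ker_eq_bot, ← ne_eq, Submodule.ne_bot_iff] at hninj
  obtain ⟨v, hv, hv0⟩ := hninj
  obtain ⟨j, hj⟩ := Function.ne_iff.1 hv0
  choose w hw using fun j => residue_surjective (R := Localization.AtPrime P) (v j)
  obtain rfl : (fun j => residue _ (w j)) = v := funext hw
  refine ExtMod.le_of_exact (f := fun i => ((D i).map (algebraMap A _)).mulVecLin) hloc.1 hloc.2 w j
    ?_ (fun l => ?_) hdim
  · by_contra hu
    exact hj ((residue_eq_zero_iff _).2 ((mem_maximalIdeal _).2 hu))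
  · rw [← residue_eq_zero_iff, mulVecLin_apply, ← map_mulVec_apply, map_algebraMap_map_residue]
    exact congrFun hv l

/-- A criterion of exactness: the generic ranks are those of an exact complex, and the ranks drop
only at prime ideals whose height is at least the length of the complex. -/
theorem isExactComplex_of_forall_le_height [IsRegularRing A]
    (hD : ∀ i, i + 1 < n → D (i + 1) * D i = 0) (h0 : (D 0).genericRank = q 0)
    (hr : ∀ i, i + 1 < n → (D i).genericRank + (D (i + 1)).genericRank = q (i + 1))
    (hP : ∀ (P : Ideal A) [P.IsPrime], ∀ i < n, (D i).rankAtPrime P < (D i).genericRank →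
      (n : ℕ∞) ≤ P.height) : IsExactComplex n D := by
  have hinj : Function.Injective (D 0).mulVecLin := by
    have h1 := injective_of_rank_eq _ h0
    intro x y hxy
    have h2 : (fun j => algebraMap A (FractionRing A) (x j)) =
        fun j => algebraMap A (FractionRing A) (y j) := by
      apply h1
      ext i
      rw [mulVecLin_apply, mulVecLin_apply, map_mulVec_apply, map_mulVec_apply]
      exact congrArg _ (congrFun hxy i)
    exact funext fun j => IsFractionRing.injective A (FractionRing A) (congrFun h2 j)
  refine ⟨hinj, fun k => ?_⟩
  induction k using Nat.strong_induction_on with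
  | _ k ih =>
    intro hk
    have hcomp : ∀ x, (D (k + 1)).mulVecLin ((D k).mulVecLin x) = 0 := fun x => by
      rw [mulVecLin_apply, mulVecLin_apply, mulVec_mulVec, hD k hk, zero_mulVec]
    refine fun y => ⟨fun hy => ?_, fun ⟨x, hx⟩ => hx ▸ hcomp x⟩
    by_contra hy0
    have hnt : Nontrivial ((LinearMap.ker (D (k + 1)).mulVecLin).map
        (LinearMap.range (D k).mulVecLin).mkQ) := by
      refine Submodule.nontrivial_iff_ne_bot.2 ((Submodule.ne_bot_iff _).2 ⟨_, ⟨y, hy, rfl⟩, ?_⟩)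
      rwa [ne_eq, Submodule.mkQ_apply, Submodule.Quotient.mk_eq_zero]
    -- P is an associated prime of the homology, realized by a cycle z whose class in the cokernel
    -- has annihilator exactly P.
    obtain ⟨P, hPass⟩ := associatedPrimes.nonempty A ((LinearMap.ker (D (k + 1)).mulVecLin).map
        (LinearMap.range (D k).mulVecLin).mkQ)
    obtain ⟨hPp, ⟨_, z, hz, rfl⟩, hPz⟩ := isAssociatedPrime_iff.1 (AssociatedPrimes.mem_iff.1 hPass)
    have hzP : ∀ a, a ∈ P ↔ ∃ x, (D k).mulVecLin x = a • z := by
      intro a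
      rw [hPz, Submodule.mem_colon_singleton, Submodule.mem_bot, ← Submodule.coe_eq_zero,
        Submodule.coe_smul, ← map_smul, Submodule.mkQ_apply, Submodule.Quotient.mk_eq_zero]
      rfl
    set R := Localization.AtPrime P
    let f : ∀ i, (Fin (q i) → R) →ₗ[R] (Fin (q (i + 1)) → R) :=
      fun i => ((D i).map (algebraMap A R)).mulVecLin
    let z' : Fin (q (k + 1)) → R := fun i => algebraMap A R (z i)
    have hS : P.primeCompl ≤ nonZeroDivisors A := P.primeCompl_le_nonZeroDivisors
    have hRinj : Function.Injective (algebraMap A R) := IsLocalization.injective R hS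
    have hz'k : f (k + 1) z' = 0 := by
      ext i
      rw [mulVecLin_apply, map_mulVec_apply, ← mulVecLin_apply, hz, Pi.zero_apply, map_zero,
        Pi.zero_apply]
    have hz' : z' ∉ LinearMap.range (f k) := by
      rintro ⟨x, hx⟩
      obtain ⟨s, hs, w, hw⟩ := exists_smul_eq_algebraMap P.primeCompl x
      refine hs ((hzP s).2 ⟨w, funext fun i => hRinj ?_⟩)
      have h1 : (algebraMap A R s • f k x) i = (algebraMap A R s • z') i := by rw [hx]
      rw [← map_smul, hw, mulVecLin_apply, map_mulVec_apply] at h1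
      rw [mulVecLin_apply, h1, Pi.smul_apply, Pi.smul_apply, smul_eq_mul, smul_eq_mul, map_mul]
    -- If neither rank drops, the complex is exact at P and z would be a boundary there. Otherwise P
    -- has height at least n, and a depth argument applies.
    by_cases hdrop : (D k).rankAtPrime P = (D k).genericRank ∧
        (D (k + 1)).rankAtPrime P = (D (k + 1)).genericRank
    · refine hz' ((IsLocalRing.exact_of_rank_add_rank _ _ ?_ ?_ z').1 hz'k)
      · rw [← Matrix.map_mul, hD k hk, Matrix.map_zero _ (map_zero _)]
      · exact (congrArg₂ (· + ·) hdrop.1 hdrop.2).trans (hr k hk)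
    · have hle : (n : ℕ∞) ≤ P.height := by
        rw [not_and_or] at hdrop
        rcases hdrop with h | h
        · exact hP P k (by omega) ((rankAtPrime_le_genericRank _ P).lt_of_ne h)
        · exact hP P (k + 1) hk ((rankAtPrime_le_genericRank _ P).lt_of_ne h)
      obtain ⟨m, hm⟩ := ENat.ne_top_iff_exists.1 (Ideal.height_ne_top_of_isPrime (I := P))
      have hdim : ringKrullDim R = m := by
        rw [IsLocalization.AtPrime.ringKrullDim_eq_height P, ← hm]
        rfl
      rw [← hm] at hle
      norm_cast at hle
      have hreg : IsRegularLocalRing R :=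
        IsRegularRing.isRegularLocalRing_localization P
      -- The complex is exact to the left of k by induction, and k + 1 < n is at most the depth of
      -- R. Hence there are no non-zero maps from the residue field to the cokernel.
      have hext := ExtMod.subsingleton_coker (f := f)
        (fun i hi => ExtMod.subsingleton_of_isRegularLocalRing R hdim i hi)
        (injective_map_of_isLocalization hS hinj) k
        (fun i hi => exact_map_of_isLocalization hS (ih i hi (by omega))) 0 (by omega)
      rw [ExtMod.subsingleton_zero_iff] at hext
      -- The class of z is killed by P, so it defines such a map; its vanishing makes z a local
      -- boundary.
      let g : R →ₗ[R] ((Fin (q (k + 1)) → R) ⧸ LinearMap.range (f k)) :=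
        LinearMap.toSpanSingleton R _ (Submodule.Quotient.mk z')
      have hg : maximalIdeal R ≤ LinearMap.ker g := by
        rw [← Localization.AtPrime.map_eq_maximalIdeal, Ideal.map_le_iff_le_comap]
        intro a ha
        obtain ⟨x, hx⟩ := (hzP a).1 ha
        rw [Ideal.mem_comap, LinearMap.mem_ker, LinearMap.toSpanSingleton_apply,
          ← Submodule.Quotient.mk_smul, Submodule.Quotient.mk_eq_zero]
        refine ⟨fun i => algebraMap A R (x i), funext fun i => ?_⟩
        rw [mulVecLin_apply, map_mulVec_apply, ← mulVecLin_apply, hx, Pi.smul_apply, Pi.smul_apply,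
          smul_eq_mul, smul_eq_mul, map_mul]
      have h1 := LinearMap.congr_fun (hext.elim (Submodule.liftQ (maximalIdeal R) g hg) 0)
        (Submodule.Quotient.mk 1)
      rw [Submodule.liftQ_apply, LinearMap.toSpanSingleton_apply, one_smul] at h1
      exact hz' ((Submodule.Quotient.mk_eq_zero _).1 h1)

end IsDomain

end Matrix

end MatrixComplex

noncomputable section

namespace OrbitComplex

open MvPolynomial

/-! ### Geometry of orbits -/

section Orbits

variable {N : ℕ} {G : Type*} [Group G] (ρ : Representation ℂ G (Fin N → ℂ))

theorem vanishingIdeal_zariskiClosure (S : Set (Fin N → ℂ)) :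
    vanishingIdeal ℂ (zariskiClosure S) = vanishingIdeal ℂ S :=
  le_antisymm (vanishingIdeal_anti_mono (zeroLocus_vanishingIdeal_le S))
    (le_vanishingIdeal_zeroLocus _)

theorem vanishingIdeal_orbitClosure (x : Fin N → ℂ) :
    vanishingIdeal ℂ (orbitClosure ρ x) = vanishingIdeal ℂ (orbit ρ x) :=
  vanishingIdeal_zariskiClosure _

theorem mem_vanishingIdeal_orbit {x : Fin N → ℂ} {f : Poly N} :
    f ∈ vanishingIdeal ℂ (orbit ρ x) ↔ ∀ g, eval (ρ g x) f = 0 := by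
  rw [mem_vanishingIdeal_iff]
  constructor
  · intro h g
    exact h _ ⟨g, rfl⟩
  · rintro h _ ⟨g, rfl⟩
    exact h g

theorem vanishingIdeal_orbit_eq_bot {x : Fin N → ℂ} (hx : orbitClosure ρ x = Set.univ) :
    vanishingIdeal ℂ (orbit ρ x) = ⊥ := by
  rw [← vanishingIdeal_orbitClosure, hx, eq_bot_iff]
  intro f hf
  exact MvPolynomial.funext fun y => by simpa using hf y trivial

end Orbits

/-! ### Constancy of ranks along orbits, and degeneracy loci -/

namespace GradedFreeComplex

variable {N n : ℕ} (F : GradedFreeComplex N n)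

theorem rankAt_le_genericRank (k : ℕ) (x : Fin N → ℂ) : F.rankAt k x ≤ (F.d k).genericRank := by
  refine Matrix.rank_map_le_rank_map_of_ker_le _ _ (eval x) ?_
  rw [(RingHom.injective_iff_ker_eq_bot _).1 (IsFractionRing.injective _ (FractionRing (Poly N)))]
  exact bot_le

theorem rankAt_le_rankAtPrime (k : ℕ) (x : Fin N → ℂ) (P : Ideal (Poly N)) [P.IsPrime]
    (hx : x ∈ zeroLocus ℂ P) : F.rankAt k x ≤ (F.d k).rankAtPrime P := by
  refine Matrix.rank_map_le_rank_map_of_ker_le _ _ (eval x) fun f hf => ?_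
  rw [RingHom.mem_ker, Ideal.algebraMap_residueField_eq_zero] at hf
  exact hx f hf

theorem rankAt_zero (hmin : F.IsMinimal) (k : ℕ) : F.rankAt k 0 = 0 := by
  have : (F.d k).map (eval (0 : Fin N → ℂ)) = 0 := by
    ext i j
    rw [Matrix.map_apply, Matrix.zero_apply, MvPolynomial.eval_zero]
    exact hmin k i j
  unfold rankAt
  rw [this, Matrix.rank_zero]

theorem genericRank_pos {k : ℕ} (hd : F.d k ≠ 0) : 0 < (F.d k).genericRank := by
  rw [Nat.pos_iff_ne_zero]
  intro h
  refine hd (Matrix.ext fun i j => ?_)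
  by_contra hij
  have h1 := Matrix.le_rank_of_submatrix_det_ne_zero (r := 1)
    ((F.d k).map (algebraMap _ (FractionRing (Poly N)))) (fun _ => i) (fun _ => j) (by
      rw [Matrix.det_fin_one, Matrix.submatrix_apply, Matrix.map_apply, ne_eq,
        FaithfulSMul.algebraMap_eq_zero_iff]
      exact hij)
  unfold Matrix.genericRank at h
  omega

section Equivariant

variable {G : Type*} [Group G] {ρ : Representation ℂ G (Fin N → ℂ)}
variable {F} (E : EquivariantStructure ρ F)

/-- The value at `x` of the matrix of the action of `g` on `F_k`. -/
def actMatrix (k : ℕ) (g : G) (x : Fin N → ℂ) : Matrix (Fin (F.rank k)) (Fin (F.rank k)) ℂ :=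
  fun i j => eval x (E.act k g (Pi.single j 1) i)

/-- The semilinear action on sections induces a linear map from the fibre at g⁻¹x to the fibre at x:
coefficients are moved by `polyAction`, whose value at x is the value at g⁻¹x. -/
theorem actMatrix_mulVec (k : ℕ) (g : G) (x : Fin N → ℂ) (f : F.Mod k) :
    (actMatrix E k g x).mulVec (fun j => eval (ρ g⁻¹ x) (f j)) =
      fun i => eval x (E.act k g f i) := by
  have hf : f = ∑ j, f j • Pi.single (M := fun _ => Poly N) j 1 := by
    ext1 i
    simp [Finset.sum_apply, Pi.single_apply]
  ext i
  have h1 : E.act k g f = ∑ j, E.act k g (f j • Pi.single (M := fun _ => Poly N) j 1) := by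
    conv_lhs => rw [hf]
    exact map_sum (E.act k g : F.Mod k →+ F.Mod k) _ _
  have h2 : eval x (E.act k g f i) =
      ∑ j, eval x (E.act k g (f j • Pi.single (M := fun _ => Poly N) j 1) i) := by
    rw [h1, Finset.sum_apply, map_sum]
  rw [h2]
  unfold Matrix.mulVec dotProduct
  refine Finset.sum_congr rfl fun j _ => ?_
  rw [E.act_smul, Pi.smul_apply, smul_eq_mul, map_mul, eval_polyAction, mul_comm]
  rfl

theorem actMatrix_surjective (k : ℕ) (g : G) (x : Fin N → ℂ) :
    Function.Surjective (actMatrix E k g x).mulVecLin := by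
  intro v
  -- The preimage is the value of g⁻¹ applied to the constant section v.
  refine ⟨fun j => eval (ρ g⁻¹ x) (E.act k g⁻¹ (fun i => C (v i)) j), ?_⟩
  rw [Matrix.mulVecLin_apply, actMatrix_mulVec]
  have : E.act k g (E.act k g⁻¹ fun i => C (v i)) = fun i => C (v i) := by
    change (E.act k g * E.act k g⁻¹) _ = _
    rw [← map_mul, mul_inv_cancel, map_one]
    rfl
  rw [this]
  simp

theorem actMatrix_mul (k : ℕ) (g : G) (x : Fin N → ℂ) :
    actMatrix E k g x * (F.d k).map (eval (ρ g⁻¹ x)) =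
      (F.d k).map (eval x) * actMatrix E (k + 1) g x := by
  refine Matrix.ext_of_mulVec_single fun j => ?_
  have h1 : Pi.single (M := fun _ => ℂ) j 1 = fun l => eval (ρ g⁻¹ x)
      ((Pi.single j 1 : F.Mod (k + 1)) l) := by
    ext l
    by_cases hl : l = j
    · subst hl; simp
    · simp [Pi.single_eq_of_ne hl]
  ext i
  rw [h1, ← Matrix.mulVec_mulVec, ← Matrix.mulVec_mulVec, actMatrix_mulVec,
    Matrix.map_mulVec_apply]
  have h2 : ((F.d k).map (eval (ρ g⁻¹ x))).mulVec (fun l => eval (ρ g⁻¹ x)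
      ((Pi.single j 1 : F.Mod (k + 1)) l)) =
      fun l => eval (ρ g⁻¹ x) (F.diff k (Pi.single j 1) l) :=
    funext fun l => Matrix.map_mulVec_apply _ _ _ _
  rw [h2, actMatrix_mulVec, E.act_diff]
  rfl

theorem rankAt_le_rankAt_inv (E : EquivariantStructure ρ F) (k : ℕ) (g : G) (x : Fin N → ℂ) :
    F.rankAt k x ≤ F.rankAt k (ρ g⁻¹ x) := by
  have h1 : ((F.d k).map (eval x) * actMatrix E (k + 1) g x).rank = F.rankAt k x := by
    unfold rankAt Matrix.rank
    rw [Matrix.mulVecLin_mul, LinearMap.range_comp_of_range_eq_top _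
      (LinearMap.range_eq_top.2 (actMatrix_surjective E (k + 1) g x))]
  rw [← h1, ← actMatrix_mul]
  exact Matrix.rank_mul_le_right _ _

theorem rankAt_act (E : EquivariantStructure ρ F) (k : ℕ) (g : G) (x : Fin N → ℂ) :
    F.rankAt k (ρ g x) = F.rankAt k x := by
  apply le_antisymm
  · have h := rankAt_le_rankAt_inv E k g (ρ g x)
    rwa [← Module.End.mul_apply, ← map_mul, inv_mul_cancel, map_one, Module.End.one_apply] at h
  · have h := rankAt_le_rankAt_inv E k g⁻¹ x
    rwa [inv_inv] at h

/-- A minor non-zero at P is outside the ideal of the orbit, hence non-zero at some orbit point, and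
the rank is the same at all of them. -/
theorem rankAtPrime_le_rankAt (E : EquivariantStructure ρ F) (k : ℕ) (x : Fin N → ℂ)
    (P : Ideal (Poly N)) [P.IsPrime] (hP : vanishingIdeal ℂ (orbit ρ x) ≤ P) :
    (F.d k).rankAtPrime P ≤ F.rankAt k x := by
  obtain ⟨g, hg⟩ := Matrix.exists_rank_map_le_rank_map (F.d k)
    (algebraMap (Poly N) P.ResidueField) (fun g : G => eval (ρ g x)) fun f hf => by
      rw [Ideal.algebraMap_residueField_eq_zero]
      exact hP ((mem_vanishingIdeal_orbit ρ).2 hf)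
  exact hg.trans_eq (rankAt_act E k g x)

theorem rankAt_eq_genericRank (E : EquivariantStructure ρ F) (k : ℕ) {x : Fin N → ℂ}
    (hx : orbitClosure ρ x = Set.univ) : F.rankAt k x = (F.d k).genericRank := by
  refine le_antisymm (F.rankAt_le_genericRank k x) ?_
  obtain ⟨g, hg⟩ := Matrix.exists_rank_map_le_rank_map (F.d k)
    (algebraMap (Poly N) (FractionRing (Poly N))) (fun g : G => eval (ρ g x)) fun f hf => by
      have h1 := (mem_vanishingIdeal_orbit ρ).2 hf
      rw [vanishingIdeal_orbit_eq_bot ρ hx, Ideal.mem_bot] at h1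
      rw [h1, map_zero]
  exact hg.trans_eq (rankAt_act E k g x)

/-- The locus where the rank of a differential drops is the union of the orbit closures contained
in it. -/
theorem exists_vanishingIdeal_orbit_le (E : EquivariantStructure ρ F) {t : ℕ}
    {p : Fin (t + 1) → (Fin N → ℂ)} (hp : ∀ x, ∃ j, x ∈ orbit ρ (p j)) (k : ℕ)
    (P : Ideal (Poly N)) [P.IsPrime] {r : ℕ} (hP : (F.d k).rankAtPrime P < r) :
    ∃ j, F.rankAt k (p j) < r ∧ vanishingIdeal ℂ (orbit ρ (p j)) ≤ P := by
  classical
  -- By the Nullstellensatz: each zero of P has rank below r, so it lies on one of the finitely many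
  -- orbits in the product. A prime containing the product contains a factor.
  have hle : ∏ j ∈ Finset.univ.filter (fun j => F.rankAt k (p j) < r),
      vanishingIdeal ℂ (orbit ρ (p j)) ≤ P := by
    refine Ideal.prod_le_inf.trans fun f hf => ?_
    rw [← MvPolynomial.IsPrime.vanishingIdeal_zeroLocus (K := ℂ) P]
    intro x hx
    obtain ⟨j, g, hg⟩ := hp x
    have hj : F.rankAt k (p j) < r := by
      rw [← rankAt_act E k g]
      simp only at hg
      rw [hg]
      exact (F.rankAt_le_rankAtPrime k x P hx).trans_lt hP
    have h1 := (Submodule.mem_finsetInf.1 hf) j (Finset.mem_filter.2 ⟨Finset.mem_univ j, hj⟩)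
    exact h1 x ⟨g, hg⟩
  obtain ⟨j, hj, hjP⟩ := (Ideal.IsPrime.prod_le inferInstance).1 hle
  exact ⟨j, (Finset.mem_filter.1 hj).2, hjP⟩

end Equivariant

end GradedFreeComplex

end OrbitComplex

end

/-! ### Transposition, reversal of the complex, and transfer of exactness -/

noncomputable section

namespace Matrix

section Transpose

variable {m n : ℕ} {A : Type*} [CommRing A]

theorem dualMap_mulVecLin_dotProductEquiv (M : Matrix (Fin m) (Fin n) A) :
    M.mulVecLin.dualMap ∘ₗ (dotProductEquiv A (Fin m)).toLinearMap =
      (dotProductEquiv A (Fin n)).toLinearMap ∘ₗ Mᵀ.mulVecLin := by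
  ext v w
  simp

theorem dualMap_mulVecLin_injective_iff (M : Matrix (Fin m) (Fin n) A) :
    Function.Injective M.mulVecLin.dualMap ↔ Function.Injective Mᵀ.mulVecLin := by
  have h := congrArg DFunLike.coe (dualMap_mulVecLin_dotProductEquiv M)
  rw [LinearMap.coe_comp, LinearMap.coe_comp] at h
  rw [← EmbeddingLike.comp_injective _ (dotProductEquiv A (Fin n)),
    ← (EquivLike.injective_comp (dotProductEquiv A (Fin m)) _)]
  exact iff_of_eq (congrArg Function.Injective h)

theorem dualMap_mulVecLin_exact_iff {k : ℕ} (M : Matrix (Fin m) (Fin n) A)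
    (M' : Matrix (Fin n) (Fin k) A) :
    Function.Exact M.mulVecLin.dualMap M'.mulVecLin.dualMap ↔
      Function.Exact Mᵀ.mulVecLin M'ᵀ.mulVecLin :=
  Function.Exact.iff_of_ladder_linearEquiv (dualMap_mulVecLin_dotProductEquiv M)
    (dualMap_mulVecLin_dotProductEquiv M')

theorem genericRank_transpose [IsDomain A] (M : Matrix (Fin m) (Fin n) A) :
    Mᵀ.genericRank = M.genericRank := by
  unfold genericRank
  rw [Matrix.transpose_map, Matrix.rank_transpose]

theorem rankAtPrime_transpose (M : Matrix (Fin m) (Fin n) A) (P : Ideal A) [P.IsPrime] :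
    Mᵀ.rankAtPrime P = M.rankAtPrime P := by
  unfold rankAtPrime
  rw [Matrix.transpose_map, Matrix.rank_transpose]

end Transpose

end Matrix

namespace OrbitComplex

namespace GradedFreeComplex

variable {N n : ℕ} (F : GradedFreeComplex N n)

theorem isEmpty_of_lt {k : ℕ} (hk : n < k) : IsEmpty (Fin (F.rank k)) := by
  rw [F.rank_eq_zero k hk]
  infer_instance

/-! ### The dual complex and the reversed complex -/

theorem dualIsExact_iff (hn : 0 < n) :
    F.DualIsExact ↔ Matrix.IsExactComplex n (q := F.rank) fun k => (F.d k).transpose := by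
  unfold DualIsExact Matrix.IsExactComplex
  refine and_congr ?_ (forall₂_congr fun k _ => Matrix.dualMap_mulVecLin_exact_iff _ _)
  rw [← Matrix.dualMap_mulVecLin_injective_iff]
  exact ⟨fun h => h hn, fun h _ => h⟩

/-- The differential `F_b → F_a` if `b = a + 1`, and zero otherwise. -/
def diffMatrix (a b : ℕ) : Matrix (Fin (F.rank a)) (Fin (F.rank b)) (Poly N) :=
  if h : a + 1 = b then (F.d a).submatrix id (Fin.cast (congrArg F.rank h.symm)) else 0

theorem diffMatrix_succ (a : ℕ) : F.diffMatrix a (a + 1) = F.d a := by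
  unfold diffMatrix
  rw [dif_pos rfl]
  rfl

/-- The ranks of the modules of the complex, numbered from the left. -/
def revRank (n : ℕ) {N : ℕ} (F : GradedFreeComplex N n) (i : ℕ) : ℕ := F.rank (n - i)

/-- The differentials of the complex, numbered from the left. -/
def revMatrix (i : ℕ) : Matrix (Fin (F.revRank n (i + 1))) (Fin (F.revRank n i)) (Poly N) :=
  F.diffMatrix (n - (i + 1)) (n - i)

/-- Free indices tied by an equation can be eliminated by `subst`, which avoids casts along the
truncated subtractions in `revMatrix`. -/
theorem diffMatrix_injective_iff {a b : ℕ} (h : a + 1 = b) :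
    Function.Injective (F.diffMatrix a b).mulVecLin ↔ Function.Injective (F.diff a) := by
  subst h
  rw [diffMatrix_succ]
  rfl

theorem diffMatrix_exact_iff {a b c : ℕ} (hab : a + 1 = b) (hbc : b + 1 = c) :
    Function.Exact (F.diffMatrix b c).mulVecLin (F.diffMatrix a b).mulVecLin ↔
      Function.Exact (F.diff (a + 1)) (F.diff a) := by
  subst hbc
  subst hab
  rw [diffMatrix_succ, diffMatrix_succ]
  rfl

theorem diffMatrix_mul {a b c : ℕ} (hab : a + 1 = b) (hbc : b + 1 = c) :
    F.diffMatrix a b * F.diffMatrix b c = 0 := by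
  subst hbc
  subst hab
  rw [diffMatrix_succ, diffMatrix_succ, F.d_comp]

theorem diffMatrix_genericRank {a b : ℕ} (h : a + 1 = b) :
    (F.diffMatrix a b).genericRank = (F.d a).genericRank := by
  subst h
  rw [diffMatrix_succ]

theorem diffMatrix_rankAtPrime {a b : ℕ} (h : a + 1 = b) (P : Ideal (Poly N)) [P.IsPrime] :
    (F.diffMatrix a b).rankAtPrime P = (F.d a).rankAtPrime P := by
  subst h
  rw [diffMatrix_succ]

theorem revMatrix_genericRank {i k : ℕ} (h : k + i + 1 = n) :
    (F.revMatrix i).genericRank = (F.d k).genericRank := by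
  obtain rfl : k = n - (i + 1) := by omega
  exact F.diffMatrix_genericRank (by omega)

theorem revMatrix_rankAtPrime {i k : ℕ} (h : k + i + 1 = n) (P : Ideal (Poly N)) [P.IsPrime] :
    (F.revMatrix i).rankAtPrime P = (F.d k).rankAtPrime P := by
  obtain rfl : k = n - (i + 1) := by omega
  exact F.diffMatrix_rankAtPrime (by omega) P

theorem isExact_iff (hn : 0 < n) : F.IsExact ↔ Matrix.IsExactComplex n F.revMatrix := by
  unfold Matrix.IsExactComplex
  -- The module after F_n is zero, so exactness at F_n is injectivity of the last differential.
  have h0 : Function.Exact (F.diff (n - 1 + 1)) (F.diff (n - 1)) ↔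
      Function.Injective (F.revMatrix 0).mulVecLin := by
    refine Iff.trans ?_ (F.diffMatrix_injective_iff (show n - (0 + 1) + 1 = n - 0 by omega)).symm
    rw [zero_add]
    have := F.isEmpty_of_lt (show n < n - 1 + 1 + 1 by omega)
    have h1 : F.diff (n - 1 + 1) = 0 := by
      ext x
      exact (this.false x).elim
    rw [h1, LinearMap.exact_zero_iff_injective]
  constructor
  · intro h
    refine ⟨h0.1 (h _), fun i hi => ?_⟩
    exact (F.diffMatrix_exact_iff (by omega) (by omega)).2 (h (n - (i + 1 + 1)))
  · rintro ⟨h1, h2⟩ k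
    rcases lt_trichotomy (k + 1) n with hk | hk | hk
    · have h3 := h2 (n - (k + 2)) (by omega)
      have h4 := (F.diffMatrix_exact_iff (by omega) (by omega)).1 h3
      rwa [show n - (n - (k + 2) + 1 + 1) = k by omega] at h4
    · rw [show k = n - 1 by omega]
      exact h0.2 h1
    · have := F.isEmpty_of_lt hk
      intro y
      rw [Subsingleton.elim y 0]
      exact ⟨fun _ => ⟨0, map_zero _⟩, fun _ => map_zero _⟩

/-! ### Ranks of the differentials -/

theorem sum_rank_eq {b r : ℕ → ℕ} (m : ℕ)
    (h : ∀ k, k < m → r k + r (k + 1) = b (k + 1)) :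
    ∑ k ∈ Finset.range (m + 1), (-1 : ℤ) ^ k * (b k : ℤ) = b 0 - r 0 + (-1) ^ m * r m := by
  induction m with
  | zero => simp
  | succ m ih =>
    rw [Finset.sum_range_succ, ih fun k hk => h k (by omega), ← h m (by omega)]
    push_cast
    ring

theorem genericRank_of_isExact (hn : 0 < n) (h : F.IsExact) :
    (F.d (n - 1)).genericRank = F.rank n ∧
      ∀ k, k + 1 < n → (F.d k).genericRank + (F.d (k + 1)).genericRank = F.rank (k + 1) := by
  rw [F.isExact_iff hn] at h
  refine ⟨?_, fun k hk => ?_⟩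
  · have h1 := h.genericRank_zero
    rwa [revMatrix_genericRank F (k := n - 1) (by omega)] at h1
  · have h1 := h.genericRank_add_genericRank (n - (k + 2)) (by omega)
    rw [revMatrix_genericRank F (k := k + 1) (by omega),
      revMatrix_genericRank F (k := k) (by omega), add_comm] at h1
    rw [h1, revRank, show n - (n - (k + 2) + 1) = k + 1 by omega]

theorem genericRank_of_dualIsExact (hn : 0 < n) (h : F.DualIsExact) :
    (F.d 0).genericRank = F.rank 0 ∧
      ∀ k, k + 1 < n → (F.d k).genericRank + (F.d (k + 1)).genericRank = F.rank (k + 1) := by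
  rw [F.dualIsExact_iff hn] at h
  refine ⟨?_, fun k hk => ?_⟩
  · rw [← Matrix.genericRank_transpose]
    exact h.genericRank_zero
  · rw [← Matrix.genericRank_transpose, ← Matrix.genericRank_transpose (F.d (k + 1))]
    exact h.genericRank_add_genericRank k hk

/-- The alternating sum telescopes to the rank defects at the two ends, so when it vanishes, full
rank at one end forces full rank at the other. -/
theorem sum_rank_eq_of_genericRank (hn : 0 < n)
    (h : ∀ k, k + 1 < n → (F.d k).genericRank + (F.d (k + 1)).genericRank = F.rank (k + 1)) :
    ∑ k ∈ Finset.range (n + 1), (-1 : ℤ) ^ k * (F.rank k : ℤ) =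
      F.rank 0 - (F.d 0).genericRank +
        (-1) ^ n * (F.rank n - (F.d (n - 1)).genericRank) := by
  obtain ⟨m, rfl⟩ : ∃ m, n = m + 1 := ⟨n - 1, by omega⟩
  rw [Finset.sum_range_succ, sum_rank_eq (r := fun k => (F.d k).genericRank) m
    fun k hk => h k (by omega)]
  rw [Nat.add_sub_cancel]
  ring

/-! ### Exactness and the codimension of the degeneracy loci -/

theorem le_height_of_isExact (hn : 0 < n) (h : F.IsExact) (P : Ideal (Poly N)) [P.IsPrime]
    (hP : (F.d (n - 1)).rankAtPrime P < (F.d (n - 1)).genericRank) : (n : ℕ∞) ≤ P.height := by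
  refine ((F.isExact_iff hn).1 h).le_height P ?_
  rwa [revMatrix_genericRank F (k := n - 1) (by omega),
    revMatrix_rankAtPrime F (k := n - 1) (by omega)]

theorem le_height_of_dualIsExact (hn : 0 < n) (h : F.DualIsExact) (P : Ideal (Poly N)) [P.IsPrime]
    (hP : (F.d 0).rankAtPrime P < (F.d 0).genericRank) : (n : ℕ∞) ≤ P.height := by
  refine ((F.dualIsExact_iff hn).1 h).le_height P ?_
  rwa [Matrix.genericRank_transpose, Matrix.rankAtPrime_transpose]

theorem isExact_of_forall_le_height (hn : 0 < n)
    (h0 : (F.d (n - 1)).genericRank = F.rank n)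
    (hr : ∀ k, k + 1 < n → (F.d k).genericRank + (F.d (k + 1)).genericRank = F.rank (k + 1))
    (hP : ∀ (P : Ideal (Poly N)) [P.IsPrime], ∀ k < n,
      (F.d k).rankAtPrime P < (F.d k).genericRank → (n : ℕ∞) ≤ P.height) : F.IsExact := by
  rw [F.isExact_iff hn]
  refine Matrix.isExactComplex_of_forall_le_height (fun i hi => ?_) ?_ (fun i hi => ?_) ?_
  · exact F.diffMatrix_mul (by omega) (by omega)
  · rw [revMatrix_genericRank F (k := n - 1) (by omega)]
    exact h0
  · obtain ⟨k, rfl⟩ : ∃ k, n = k + 1 + i + 1 := ⟨n - (i + 2), by omega⟩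
    rw [revMatrix_genericRank F (k := k + 1) (by omega),
      revMatrix_genericRank F (k := k) (by omega), add_comm, revRank, hr k (by omega),
      show k + 1 + i + 1 - (i + 1) = k + 1 by omega]
  · intro P _ i hi h
    rw [revMatrix_genericRank F (k := n - (i + 1)) (by omega),
      revMatrix_rankAtPrime F (k := n - (i + 1)) (by omega)] at h
    exact hP P _ (by omega) h

theorem dualIsExact_of_forall_le_height (hn : 0 < n)
    (h0 : (F.d 0).genericRank = F.rank 0)
    (hr : ∀ k, k + 1 < n → (F.d k).genericRank + (F.d (k + 1)).genericRank = F.rank (k + 1))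
    (hP : ∀ (P : Ideal (Poly N)) [P.IsPrime], ∀ k < n,
      (F.d k).rankAtPrime P < (F.d k).genericRank → (n : ℕ∞) ≤ P.height) : F.DualIsExact := by
  rw [F.dualIsExact_iff hn]
  refine Matrix.isExactComplex_of_forall_le_height (fun i hi => ?_) ?_ (fun i hi => ?_) ?_
  · rw [← Matrix.transpose_mul, F.d_comp, Matrix.transpose_zero]
  · rwa [Matrix.genericRank_transpose]
  · rw [Matrix.genericRank_transpose, Matrix.genericRank_transpose]
    exact hr i hi
  · intro P _ i hi h
    rw [Matrix.genericRank_transpose, Matrix.rankAtPrime_transpose] at h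
    exact hP P i hi h

/-- If one orbit of minimal codimension lies in the degeneracy loci of all the differentials, then
a bound for the codimension of one degeneracy locus holds for all of them. -/
theorem le_height_of_forall_le_height {t : ℕ} {G : Type*} [Group G]
    {ρ : Representation ℂ G (Fin N → ℂ)} (E : EquivariantStructure ρ F) (hmin : F.IsMinimal)
    {p : Fin (t + 1) → (Fin N → ℂ)} (hp : ∀ x, ∃ j, x ∈ orbit ρ (p j))
    {pgen : Fin N → ℂ} (hpgen : orbitClosure ρ pgen = Set.univ)
    (hdrop : ∃ j₀ : Fin (t + 1), ∀ k < n, ∀ j : Fin (t + 1),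
      F.rankAt k (p j) < F.rankAt k pgen →
        F.rankAt k (p j₀) < F.rankAt k pgen ∧
          codim (orbitClosure ρ (p j₀)) ≤ codim (orbitClosure ρ (p j)))
    {k₀ : ℕ} (hk₀ : k₀ < n) (hd : ∀ k < n, F.d k ≠ 0)
    (h : ∀ (P : Ideal (Poly N)) [P.IsPrime],
      (F.d k₀).rankAtPrime P < (F.d k₀).genericRank → (n : ℕ∞) ≤ P.height)
    (P : Ideal (Poly N)) [P.IsPrime] (k : ℕ) (hk : k < n)
    (hP : (F.d k).rankAtPrime P < (F.d k).genericRank) : (n : ℕ∞) ≤ P.height := by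
  obtain ⟨j₀, hj₀⟩ := hdrop
  simp only [rankAt_eq_genericRank E _ hpgen] at hj₀
  -- By minimality the matrices vanish at the origin, so its orbit triggers the hypothesis for k₀
  -- and shows that `d k₀` degenerates at `p j₀`.
  obtain ⟨j, g, hg⟩ := hp 0
  have h1 : F.rankAt k₀ (p j) < (F.d k₀).genericRank := by
    rw [← rankAt_act E k₀ g]
    simp only at hg
    rw [hg, F.rankAt_zero hmin]
    exact F.genericRank_pos (hd _ hk₀)
  -- Every minimal prime over the ideal of this orbit is a degeneracy prime of `d k₀`.
  have h2 : (n : ℕ∞) ≤ codim (orbitClosure ρ (p j₀)) := by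
    unfold codim
    rw [vanishingIdeal_orbitClosure, Ideal.height_eq_inf_minimalPrimes]
    refine le_iInf₂ fun J hJ => ?_
    have := hJ.1.1
    exact h J ((rankAtPrime_le_rankAt E k₀ _ J hJ.1.2).trans_lt (hj₀ k₀ hk₀ j h1).1)
  obtain ⟨i, hi, hiP⟩ := exists_vanishingIdeal_orbit_le E hp k P hP
  refine (h2.trans (hj₀ k hk i hi).2).trans ?_
  unfold codim
  rw [vanishingIdeal_orbitClosure]
  exact Ideal.height_mono hiP

end GradedFreeComplex

end OrbitComplex

end

/-! ### Contravariant Ext, grade and projective dimension of the cokernel -/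

noncomputable section

namespace ExtMod

section Contravariant

open CategoryTheory Abelian

universe u

variable {R : Type u} [CommRing R] {K X M : Type u} [AddCommGroup K] [Module R K]
  [AddCommGroup X] [Module R X] [AddCommGroup M] [Module R M] {f : K →ₗ[R] X} {g : X →ₗ[R] M}
  (T : Type u) [AddCommGroup T] [Module R T]

theorem subsingleton_of_projective [Module.Projective R X] (i : ℕ) :
    Subsingleton (ExtMod R X T (i + 1)) := by
  have : Projective (ModuleCat.of R X) := (IsProjective.iff_projective _).1 inferInstance
  exact subsingleton_of_forall_eq 0 fun x => Ext.eq_zero_of_projective x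

/-- Dimension shifting in the first variable. -/
theorem subsingleton_add_two_iff [Module.Projective R X] (hf : Function.Injective f)
    (hfg : Function.Exact f g) (hg : Function.Surjective g) (i : ℕ) :
    Subsingleton (ExtMod R M T (i + 2)) ↔ Subsingleton (ExtMod R K T (i + 1)) := by
  have hS := shortExact hf hfg hg
  constructor
  · intro h
    refine subsingleton_of_forall_eq 0 fun x => ?_
    obtain ⟨y, rfl⟩ := Ext.contravariant_sequence_exact₁ hS (ModuleCat.of R T) x
      (show 1 + (i + 1) = i + 2 by omega) (h.elim _ _)
    rw [(subsingleton_of_projective T i).elim y 0, Ext.comp_zero]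
  · intro h
    refine subsingleton_of_forall_eq 0 fun x => ?_
    obtain ⟨y, rfl⟩ := Ext.contravariant_sequence_exact₃ hS (ModuleCat.of R T) x
      ((subsingleton_of_projective (X := X) T (i + 1)).elim _ _)
      (show 1 + (i + 1) = i + 2 by omega)
    rw [h.elim y 0, Ext.comp_zero]

/-- The first `Ext` group is the obstruction to the extension of homomorphisms. -/
theorem subsingleton_one_iff [Module.Projective R X] (hf : Function.Injective f)
    (hfg : Function.Exact f g) (hg : Function.Surjective g) :
    Subsingleton (ExtMod R M T 1) ↔ ∀ φ : K →ₗ[R] T, ∃ ψ : X →ₗ[R] T, ψ ∘ₗ f = φ := by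
  have hS := shortExact hf hfg hg
  constructor
  · intro h φ
    obtain ⟨y, hy⟩ := Ext.contravariant_sequence_exact₁ hS (ModuleCat.of R T)
      (Ext.mk₀ (ModuleCat.ofHom φ)) (show 1 + 0 = 1 by omega) (h.elim _ _)
    obtain ⟨ψ, rfl⟩ := Ext.homEquiv₀.symm.surjective y
    refine ⟨ψ.hom, ?_⟩
    rw [Ext.homEquiv₀_symm_apply, Ext.mk₀_comp_mk₀] at hy
    have h2 := congrArg ModuleCat.Hom.hom (Ext.homEquiv₀.symm.injective hy)
    exact h2
  · intro h
    refine subsingleton_of_forall_eq 0 fun x => ?_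
    obtain ⟨y, rfl⟩ := Ext.contravariant_sequence_exact₃ hS (ModuleCat.of R T) x
      ((subsingleton_of_projective (X := X) T 0).elim _ _) (show 1 + 0 = 1 by omega)
    obtain ⟨φ, rfl⟩ := Ext.homEquiv₀.symm.surjective y
    obtain ⟨ψ, hψ⟩ := h φ.hom
    have h2 : φ = (ModuleCat.shortComplexOfCompEqZero f g hfg.linearMap_comp_eq_zero).f ≫
        ModuleCat.ofHom ψ := by
      ext1
      exact hψ.symm
    rw [Ext.homEquiv₀_symm_apply, h2, ← Ext.mk₀_comp_mk₀, hS.extClass_comp_assoc]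

end Contravariant

end ExtMod

namespace OrbitComplex

namespace GradedFreeComplex

variable {N n : ℕ} (F : GradedFreeComplex N n)

open CategoryTheory

/-! ### The cokernels of a free resolution -/

/-- The cokernel of the differential `F_{k+1} → F_k`. -/
abbrev CokerAt (k : ℕ) : Type := F.Mod k ⧸ LinearMap.range (F.diff k)

theorem diff_comp_diff (k : ℕ) : F.diff k ∘ₗ F.diff (k + 1) = 0 := by
  unfold diff
  rw [← Matrix.mulVecLin_mul, F.d_comp, Matrix.mulVecLin_zero]

/-- The map induced by a differential on the cokernel of the previous one. -/
def cokerMap (k : ℕ) : F.CokerAt (k + 1) →ₗ[Poly N] F.Mod k :=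
  (LinearMap.range (F.diff (k + 1))).liftQ (F.diff k)
    (LinearMap.range_le_ker_iff.2 (F.diff_comp_diff k))

theorem cokerMap_comp_mkQ (k : ℕ) :
    F.cokerMap k ∘ₗ (LinearMap.range (F.diff (k + 1))).mkQ = F.diff k :=
  Submodule.liftQ_mkQ _ _ _

/-- With `cokerMap_exact` this gives short exact sequences 0 → coker_{k+1} → F_k → coker_k → 0, so
the cokernels serve as syzygies. -/
theorem cokerMap_injective {k : ℕ} (h : Function.Exact (F.diff (k + 1)) (F.diff k)) :
    Function.Injective (F.cokerMap k) := by
  rw [← LinearMap.ker_eq_bot]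
  exact Submodule.ker_liftQ_eq_bot _ _ _ h.linearMap_ker_eq.le

theorem cokerMap_exact (k : ℕ) :
    Function.Exact (F.cokerMap k) (LinearMap.range (F.diff k)).mkQ := by
  rw [LinearMap.exact_iff, Submodule.ker_mkQ, cokerMap, Submodule.range_liftQ]

theorem subsingleton_ext_coker_iff (h : F.IsExact) (T : Type) [AddCommGroup T] [Module (Poly N) T]
    (i k : ℕ) : Subsingleton (ExtMod (Poly N) (F.CokerAt k) T (i + 1)) ↔
      Subsingleton (ExtMod (Poly N) (F.CokerAt (k + i)) T 1) := by
  induction i generalizing k with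
  | zero => rfl
  | succ i ih =>
    rw [ExtMod.subsingleton_add_two_iff T (F.cokerMap_injective (h k)) (F.cokerMap_exact k)
      (Submodule.mkQ_surjective _), ih (k + 1), show k + 1 + i = k + (i + 1) by omega]

/-- These Ext groups are the cohomology of the dual complex. In positive degree, a functional on a
syzygy is a cocycle, and writing it as a coboundary extends it to the free module. -/
theorem subsingleton_ext_coker (h : F.IsExact) (hdual : F.DualIsExact) (i : ℕ) (hi : i < n) :
    Subsingleton (ExtMod (Poly N) F.Coker (Poly N) i) := by
  cases i with
  | zero =>
    rw [ExtMod.subsingleton_zero_iff]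
    refine subsingleton_of_forall_eq 0 fun φ => ?_
    have h1 : (F.diff 0).dualMap (φ ∘ₗ (LinearMap.range (F.diff 0)).mkQ) = 0 := by
      refine LinearMap.ext fun x => ?_
      rw [LinearMap.dualMap_apply, LinearMap.comp_apply, Submodule.mkQ_apply,
        (Submodule.Quotient.mk_eq_zero _).2 (LinearMap.mem_range_self _ x), map_zero]
      rfl
    have h2 := hdual.1 hi (h1.trans (map_zero _).symm)
    exact Submodule.linearMap_qext _ h2
  | succ i =>
    rw [F.subsingleton_ext_coker_iff h, zero_add, ExtMod.subsingleton_one_iff _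
      (F.cokerMap_injective (h i)) (F.cokerMap_exact i) (Submodule.mkQ_surjective _)]
    intro φ
    have h1 : (F.diff (i + 1)).dualMap (φ ∘ₗ (LinearMap.range (F.diff (i + 1))).mkQ) = 0 := by
      refine LinearMap.ext fun x => ?_
      rw [LinearMap.dualMap_apply, LinearMap.comp_apply, Submodule.mkQ_apply,
        (Submodule.Quotient.mk_eq_zero _).2 (LinearMap.mem_range_self _ x), map_zero]
      rfl
    obtain ⟨ψ, hψ⟩ := (hdual.2 i hi _).1 h1
    refine ⟨ψ, Submodule.linearMap_qext _ ?_⟩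
    rw [LinearMap.comp_assoc, cokerMap_comp_mkQ]
    exact hψ

/-- If Ext^n vanished, a coordinate function on F_n would factor through the last differential. By
minimality such a composite has zero constant term on basis vectors, so it never takes the value 1
there. -/
theorem not_subsingleton_ext_coker (hn : 0 < n) (h : F.IsExact) (hmin : F.IsMinimal)
    (hd : F.d (n - 1) ≠ 0) : ¬ Subsingleton (ExtMod (Poly N) F.Coker (Poly N) n) := by
  obtain ⟨m, rfl⟩ : ∃ m, n = m + 1 := ⟨n - 1, by omega⟩
  rw [Nat.add_sub_cancel] at hd
  rw [F.subsingleton_ext_coker_iff h, zero_add, ExtMod.subsingleton_one_iff _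
    (F.cokerMap_injective (h m)) (F.cokerMap_exact m) (Submodule.mkQ_surjective _)]
  intro hext
  obtain ⟨j⟩ : Nonempty (Fin (F.rank (m + 1))) := by
    by_contra hempty
    rw [not_nonempty_iff] at hempty
    exact hd (Matrix.ext fun i j => (hempty.false j).elim)
  have hempty := F.isEmpty_of_lt (show m + 1 < m + 1 + 1 by omega)
  obtain ⟨ψ, hψ⟩ := hext ((LinearMap.range (F.diff (m + 1))).liftQ (LinearMap.proj j) (by
    rintro _ ⟨x, rfl⟩
    rw [Subsingleton.elim x 0, map_zero]
    exact zero_mem _))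
  have h1 : ψ (F.diff m (Pi.single j 1)) = 1 := by
    have h2 := LinearMap.congr_fun hψ (Submodule.Quotient.mk (Pi.single j 1))
    rw [Submodule.liftQ_apply, LinearMap.proj_apply, Pi.single_eq_same] at h2
    exact h2
  have h3 : F.diff m (Pi.single j 1) =
      ∑ i, F.d m i j • Pi.single (M := fun _ => Poly N) i 1 := by
    ext1 i
    rw [diff, Matrix.mulVecLin_apply, Matrix.mulVec_single_one]
    simp [Finset.sum_apply, Pi.single_apply]
  have h4 : MvPolynomial.constantCoeff (ψ (F.diff m (Pi.single j 1))) = 0 := by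
    rw [h3, map_sum, map_sum]
    refine Finset.sum_eq_zero fun i _ => ?_
    rw [LinearMap.map_smul, smul_eq_mul, map_mul, hmin, zero_mul]
  rw [h1, map_one] at h4
  exact one_ne_zero h4

/-! ### Grade and projective dimension of the cokernel -/

theorem annihilator_coker_ne_top (hn : 0 < n) (h : F.IsExact) (hmin : F.IsMinimal)
    (hd : F.d (n - 1) ≠ 0) : Module.annihilator (Poly N) F.Coker ≠ ⊤ := by
  intro htop
  refine F.not_subsingleton_ext_coker hn h hmin hd (subsingleton_of_forall_eq 0 fun x => ?_)
  rw [← one_smul (Poly N) x]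
  exact ExtMod.smul_eq_zero (htop ▸ Submodule.mem_top) _ _

theorem exists_isRegular_annihilator (hn : 0 < n) (h : F.IsExact) (hdual : F.DualIsExact)
    (hmin : F.IsMinimal) (hd : F.d (n - 1) ≠ 0) :
    ∃ rs : List (Poly N), rs.length = n ∧
      (∀ r ∈ rs, r ∈ Module.annihilator (Poly N) F.Coker) ∧
        RingTheory.Sequence.IsRegular (Poly N) rs := by
  refine ModuleCat.exists_isRegular_of_exists_subsingleton_ext
    (Module.annihilator (Poly N) F.Coker) n (ModuleCat.of (Poly N) (Poly N)) ?_
    (ModuleCat.of (Poly N) F.Coker) Module.support_eq_zeroLocus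
    (F.subsingleton_ext_coker h hdual)
  have h1 := F.annihilator_coker_ne_top hn h hmin hd
  rw [lt_top_iff_ne_top]
  change (Module.annihilator (Poly N) F.Coker) • (⊤ : Submodule (Poly N) (Poly N)) ≠ ⊤
  rwa [smul_eq_mul, Ideal.mul_top]

/-- Rees' theorem in both directions: a longer regular sequence would kill Ext^n, and the vanishing
below n produces one of length n. -/
theorem depthIdeal_annihilator_coker (hn : 0 < n) (h : F.IsExact) (hdual : F.DualIsExact)
    (hmin : F.IsMinimal) (hd : F.d (n - 1) ≠ 0) :
    depthIdeal (Module.annihilator (Poly N) F.Coker) = n := by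
  apply le_antisymm
  · refine iSup₂_le fun rs hrs => ?_
    rw [Nat.cast_le]
    by_contra! hlt
    refine F.not_subsingleton_ext_coker hn h hmin hd
      (ModuleCat.subsingleton_ext_of_exists_isRegular (Module.annihilator (Poly N) F.Coker)
        (ModuleCat.of (Poly N) F.Coker) Module.support_eq_zeroLocus.le
        (ModuleCat.of (Poly N) (Poly N)) ?_ rs hrs.1 hrs.2 n hlt)
    have h1 := F.annihilator_coker_ne_top hn h hmin hd
    rw [lt_top_iff_ne_top]
    change (Module.annihilator (Poly N) F.Coker) • (⊤ : Submodule (Poly N) (Poly N)) ≠ ⊤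
    rwa [smul_eq_mul, Ideal.mul_top]
  · obtain ⟨rs, hlen, hmem, hreg⟩ := F.exists_isRegular_annihilator hn h hdual hmin hd
    refine (congrArg (Nat.cast : ℕ → ℕ∞) hlen).ge.trans ?_
    exact le_iSup₂ (f := fun (rs : List (Poly N)) (_ : (∀ r ∈ rs,
      r ∈ Module.annihilator (Poly N) F.Coker) ∧ RingTheory.Sequence.IsRegular (Poly N) rs) =>
        (rs.length : ℕ∞)) rs ⟨hmem, hreg⟩

theorem hasProjectiveDimensionLE_coker (h : F.IsExact) (i k : ℕ) (hik : n ≤ k + i) :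
    HasProjectiveDimensionLE (ModuleCat.of (Poly N) (F.CokerAt k)) i := by
  induction i generalizing k with
  | zero =>
    rw [← projective_iff_hasProjectiveDimensionLE_zero]
    have hempty := F.isEmpty_of_lt (show n < k + 1 by omega)
    have h1 : LinearMap.range (F.diff k) = ⊥ := by
      rw [LinearMap.range_eq_bot]
      refine LinearMap.ext fun x => ?_
      rw [Subsingleton.elim x 0, map_zero, map_zero]
    have h2 : Module.Projective (Poly N) (F.CokerAt k) :=
      Module.Projective.of_equiv (Submodule.quotEquivOfEqBot _ h1).symm
    exact (IsProjective.iff_projective _).1 h2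
  | succ i ih =>
    have hS := ExtMod.shortExact (F.cokerMap_injective (h k)) (F.cokerMap_exact k)
      (Submodule.mkQ_surjective _)
    have hproj : Projective (ModuleCat.of (Poly N) (F.Mod k)) :=
      (IsProjective.iff_projective _).1 inferInstance
    exact (hS.hasProjectiveDimensionLT_X₃_iff i hproj).2 (ih (k + 1) (by omega))

theorem projectiveDimension_coker (hn : 0 < n) (h : F.IsExact) (hmin : F.IsMinimal)
    (hd : F.d (n - 1) ≠ 0) :
    projectiveDimension (ModuleCat.of (Poly N) F.Coker) = (n : ℕ) := by
  apply le_antisymm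
  · rw [projectiveDimension_le_iff]
    exact F.hasProjectiveDimensionLE_coker h n 0 (by omega)
  · rw [projectiveDimension_ge_iff]
    intro hpd
    exact F.not_subsingleton_ext_coker hn h hmin hd
      (hpd.subsingleton _ n n le_rfl (ModuleCat.of (Poly N) (Poly N)))

theorem isPerfectModule_coker (hn : 0 < n) (h : F.IsExact) (hdual : F.DualIsExact)
    (hmin : F.IsMinimal) (hd : F.d (n - 1) ≠ 0) : IsPerfectModule (Poly N) F.Coker := by
  refine ⟨inferInstance, ?_⟩
  rw [F.projectiveDimension_coker hn h hmin hd, F.depthIdeal_annihilator_coker hn h hdual hmin hd]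
  rfl

end GradedFreeComplex

end OrbitComplex

end

/-! ### Cohen–Macaulay quotients of regular domains -/

noncomputable section

/-! ### Localization of a presentation of an algebra -/

namespace Matrix

section Presentation

variable {A B R S : Type*} [CommRing A] [CommRing B] [CommRing R] [CommRing S] [Algebra A B]
  [Algebra A R] [Algebra A S] [Algebra B S] [Algebra R S] [IsScalarTower A R S]
  [IsScalarTower A B S] {m k : ℕ} (M : Matrix (Fin m) (Fin k) A) (φ : (Fin m → A) →ₗ[A] B)

/-- The linear extension of a map on a free `A`-module along `A → R`. -/
def extendScalars (R S : Type*) [CommRing R] [CommRing S] [Algebra B S] [Algebra R S] :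
    (Fin m → R) →ₗ[R] S :=
  Fintype.linearCombination R fun i => algebraMap B S (φ (Pi.single i 1))

theorem extendScalars_apply (w : Fin m → A) :
    extendScalars φ R S (fun i => algebraMap A R (w i)) = algebraMap B S (φ w) := by
  rw [extendScalars, Fintype.linearCombination_apply, LinearMap.pi_apply_eq_sum_univ φ w, map_sum]
  refine Finset.sum_congr rfl fun i _ => ?_
  rw [Algebra.smul_def, Algebra.smul_def, map_mul, ← IsScalarTower.algebraMap_apply,
    ← IsScalarTower.algebraMap_apply]
  congr 3
  ext j
  simp [Pi.single_apply, eq_comm]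

variable {φ} {P : Ideal A} [P.IsPrime] {Q : Ideal B} [Q.IsPrime]

/-- The target is localized at Q and the source at its preimage P. Surjectivity of A → B lifts
denominators outside Q to elements outside P. -/
theorem exact_extendScalars (hPQ : P = Q.comap (algebraMap A B)) [IsLocalization.AtPrime R P]
    [IsLocalization.AtPrime S Q] (hsurj : Function.Surjective (algebraMap A B))
    (h : Function.Exact M.mulVecLin φ) :
    Function.Exact (M.map (algebraMap A R)).mulVecLin (extendScalars φ R S) := by
  have e (z : Fin k → A) : (M.map (algebraMap A R)).mulVec (fun i => algebraMap A R (z i)) =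
      fun i => algebraMap A R (M.mulVec z i) := funext fun i => map_mulVec_apply _ _ _ _
  intro y
  constructor
  · intro hy
    obtain ⟨s, hs, x, hx⟩ := exists_smul_eq_algebraMap P.primeCompl y
    have h1 : algebraMap B S (φ x) = 0 := by
      rw [← extendScalars_apply (R := R), ← hx, map_smul, hy, smul_zero]
    obtain ⟨⟨b, hb⟩, hbx⟩ := (IsLocalization.map_eq_zero_iff Q.primeCompl S _).1 h1
    obtain ⟨a, rfl⟩ := hsurj b
    have ha : a ∈ P.primeCompl := by
      intro haP
      rw [hPQ] at haP
      exact hb haP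
    have h2 : φ (a • x) = 0 := by
      rw [map_smul, Algebra.smul_def]
      exact hbx
    obtain ⟨z, hz⟩ := (h _).1 h2
    have hu : IsUnit (algebraMap A R (a * s)) :=
      IsLocalization.map_units R ⟨a * s, mul_mem ha hs⟩
    refine ⟨(↑hu.unit⁻¹ : R) • fun i => algebraMap A R (z i), ?_⟩
    rw [mulVecLin_apply] at hz
    rw [map_smul, mulVecLin_apply, e, hz]
    have h3 : (fun i => algebraMap A R ((a • x) i)) = algebraMap A R (a * s) • y := by
      rw [map_mul, mul_smul, hx]
      ext i
      simp
    rw [h3, smul_smul, IsUnit.val_inv_mul, one_smul]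
  · rintro ⟨z, rfl⟩
    obtain ⟨t, ht, w, hw⟩ := exists_smul_eq_algebraMap P.primeCompl z
    have hut : IsUnit (algebraMap A R t) := IsLocalization.map_units R ⟨t, ht⟩
    have h1 := h.apply_apply_eq_zero w
    rw [mulVecLin_apply] at h1
    have h2 : extendScalars φ R S (algebraMap A R t • (M.map (algebraMap A R)).mulVecLin z) = 0 := by
      rw [← map_smul, hw, mulVecLin_apply, e, extendScalars_apply, h1, map_zero]
    rw [map_smul] at h2
    exact hut.smul_eq_zero.1 h2

theorem extendScalars_surjective (hPQ : P = Q.comap (algebraMap A B)) [IsLocalization.AtPrime R P]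
    [IsLocalization.AtPrime S Q] (hsurj : Function.Surjective (algebraMap A B))
    (h : Function.Surjective φ) : Function.Surjective (extendScalars φ R S) := by
  intro s
  obtain ⟨⟨b, ⟨t, ht⟩⟩, hbt⟩ := IsLocalization.surj Q.primeCompl s
  obtain ⟨a, rfl⟩ := hsurj t
  have ha : a ∈ P.primeCompl := by
    intro haP
    rw [hPQ] at haP
    exact ht haP
  obtain ⟨x, rfl⟩ := h b
  have hu : IsUnit (algebraMap A R a) := IsLocalization.map_units R ⟨a, ha⟩
  refine ⟨(↑hu.unit⁻¹ : R) • fun i => algebraMap A R (x i), ?_⟩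
  rw [map_smul, extendScalars_apply]
  simp only at hbt
  rw [← hbt, ← IsScalarTower.algebraMap_apply, IsScalarTower.algebraMap_apply A R S, mul_comm,
    ← Algebra.smul_def, smul_smul, IsUnit.val_inv_mul, one_smul]

end Presentation

end Matrix

namespace OrbitComplex

/-! ### A criterion for the Cohen–Macaulay property -/

section CohenMacaulay

open IsLocalRing RingTheory.Sequence

universe u

theorem length_le_ringKrullDim_of_isRegular {S : Type*} [CommRing S] [IsNoetherianRing S]
    [IsLocalRing S] {rs : List S} (h : IsRegular S rs) :
    (rs.length : WithBot ℕ∞) ≤ ringKrullDim S := by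
  have h1 : Nontrivial (S ⧸ Ideal.ofList rs) := by
    refine Ideal.Quotient.nontrivial_iff.2 fun h1 => h.top_ne_smul ?_
    rw [h1, smul_eq_mul, Ideal.mul_top]
  rw [← ringKrullDim_add_length_eq_ringKrullDim_of_isRegular rs h]
  exact le_add_of_nonneg_left ringKrullDim_nonneg_of_nontrivial

theorem depthIdeal_maximalIdeal_eq {S : Type*} [CommRing S] [IsNoetherianRing S]
    [IsLocalRing S] {rs : List S} (h : IsRegular S rs) (hrs : ∀ r ∈ rs, r ∈ maximalIdeal S)
    (hdim : ringKrullDim S ≤ rs.length) :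
    ((depthIdeal (maximalIdeal S) : ℕ∞) : WithBot ℕ∞) = ringKrullDim S := by
  have h1 := hdim.antisymm (length_le_ringKrullDim_of_isRegular h)
  have h2 : depthIdeal (maximalIdeal S) = (rs.length : ℕ∞) := by
    apply le_antisymm
    · refine iSup₂_le fun ss hss => ?_
      have h3 := length_le_ringKrullDim_of_isRegular hss.2
      rw [h1] at h3
      exact_mod_cast h3
    · exact le_iSup₂ (f := fun (rs : List S) (_ : (∀ r ∈ rs, r ∈ maximalIdeal S) ∧
        IsRegular S rs) => (rs.length : ℕ∞)) rs ⟨hrs, h⟩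
  rw [h1, h2]
  rfl

/-- Vanishing of Ext below h - n gives an S-regular sequence of length h - n, and S is a quotient of
R/(rs), of dimension h - n. Depth never exceeds dimension, so both equal h - n. -/
theorem depthIdeal_maximalIdeal_eq_of_surjective {R S : Type u} [CommRing R] [IsNoetherianRing R]
    [IsLocalRing R] [CommRing S] [IsLocalRing S] [Algebra R S]
    (hsurj : Function.Surjective (algebraMap R S)) {n h : ℕ} (hdim : ringKrullDim R = h)
    (hext : ∀ i, i + n < h → Subsingleton (ExtMod R (ResidueField R) S i))
    {rs : List R} (hlen : rs.length = n) (hreg : IsRegular R rs)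
    (hrs : ∀ r ∈ rs, algebraMap R S r = 0) :
    ((depthIdeal (maximalIdeal S) : ℕ∞) : WithBot ℕ∞) = ringKrullDim S := by
  have hnoeth : IsNoetherianRing S := isNoetherianRing_of_surjective R S _ hsurj
  have hfin : Module.Finite R S := Module.Finite.of_surjective (Algebra.linearMap R S) hsurj
  have hloc : IsLocalHom (algebraMap R S) := IsLocalHom.of_surjective _ hsurj
  have hnh : n ≤ h := by
    have := length_le_ringKrullDim_of_isRegular hreg
    rw [hdim, hlen] at this
    exact_mod_cast this
  obtain ⟨e, rfl⟩ := Nat.exists_eq_add_of_le' hnh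
  obtain ⟨ss, hss, hssm, hssr⟩ := ExtMod.exists_isRegular (R := R) (M := S) (h := e)
    fun i hi => hext i (by omega)
  have hmem : ∀ s ∈ ss.map (algebraMap R S), s ∈ maximalIdeal S := by
    intro s hs
    obtain ⟨r, hr, rfl⟩ := List.mem_map.1 hs
    exact map_nonunit (algebraMap R S) r (hssm r hr)
  have hwr : IsWeaklyRegular S (ss.map (algebraMap R S)) :=
    (isWeaklyRegular_map_algebraMap_iff S S ss).2 hssr.1
  refine depthIdeal_maximalIdeal_eq
    (IsRegular.of_isWeaklyRegular_of_mem_maximalIdeal (L := S) hmem hwr) hmem ?_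
  rw [List.length_map, hss]
  have hle : Ideal.ofList rs ≤ RingHom.ker (algebraMap R S) := Ideal.span_le.2 fun r hr => hrs r hr
  have h1 : ringKrullDim S ≤ ringKrullDim (R ⧸ Ideal.ofList rs) :=
    ringKrullDim_le_of_surjective
      (Ideal.Quotient.lift (Ideal.ofList rs) (algebraMap R S) fun r hr => hle hr)
      (Ideal.Quotient.lift_surjective_of_surjective _ _ hsurj)
  refine h1.trans ?_
  have h2 := ringKrullDim_add_length_eq_ringKrullDim_of_isRegular rs hreg
  rw [hdim, hlen] at h2
  generalize ringKrullDim (R ⧸ Ideal.ofList rs) = x at h2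
  induction x using WithBot.recBotCoe with
  | bot => exact bot_le
  | coe x =>
    have h3 : x + n = (e + n : ℕ) := by exact_mod_cast h2
    rw [Nat.cast_add] at h3
    have h4 : x = e := ENat.add_left_injective_of_ne_top (ENat.natCast_ne_top n) h3
    rw [h4]
    rfl

/-- A quotient of a regular domain which has a free resolution whose length is the length of a
regular sequence in the ideal is Cohen–Macaulay. -/
theorem isCohenMacaulayRing_quotient {A : Type u} [CommRing A] [IsDomain A] [IsRegularRing A]
    {I : Ideal A} {q : ℕ → ℕ} {m : ℕ} {D : ∀ i, Matrix (Fin (q (i + 1))) (Fin (q i)) A}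
    (hD : Matrix.IsExactComplex (m + 1) D) {φ : (Fin (q (m + 1)) → A) →ₗ[A] A ⧸ I}
    (hφ : Function.Surjective φ) (hex : Function.Exact (D m).mulVecLin φ)
    {rs : List A} (hlen : rs.length = m + 1) (hreg : IsRegular A rs) (hrs : ∀ r ∈ rs, r ∈ I) :
    IsCohenMacaulayRing (A ⧸ I) := by
  refine ⟨inferInstance, fun Q _ => ?_⟩
  set P : Ideal A := Q.comap (Ideal.Quotient.mk I) with hP
  let R := Localization.AtPrime P
  let S := Localization.AtPrime Q
  let alg : Algebra R S := (Localization.localRingHom P Q (Ideal.Quotient.mk I) rfl).toAlgebra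
  have htower : IsScalarTower A R S := IsScalarTower.of_algebraMap_eq fun a =>
    (Localization.localRingHom_to_map P Q (Ideal.Quotient.mk I) rfl a).symm
  have hsurj : Function.Surjective (algebraMap R S) :=
    RingHom.surjectiveOnStalks_of_surjective Ideal.Quotient.mk_surjective Q inferInstance
  obtain ⟨h, hh⟩ := ENat.ne_top_iff_exists.1 (Ideal.height_ne_top_of_isPrime (I := P))
  have hdim : ringKrullDim R = h := by
    rw [IsLocalization.AtPrime.ringKrullDim_eq_height P R, ← hh]
    rfl
  have hloc := hD.map_of_isLocalization P.primeCompl_le_nonZeroDivisors R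
  have hIP : I ≤ P := fun a ha => by
    rw [hP, Ideal.mem_comap, Ideal.Quotient.eq_zero_iff_mem.2 ha]
    exact zero_mem Q
  refine depthIdeal_maximalIdeal_eq_of_surjective (R := R) (n := m + 1) hsurj hdim
    (fun i hi => ?_) (rs := rs.map (algebraMap A R)) (by rw [List.length_map, hlen])
    (hreg.1.isRegular_of_isLocalization_of_mem R P fun r hr => hIP (hrs r hr)) fun r hr => ?_
  -- The local resolution ends in a cokernel isomorphic to S, and shifting along it costs m + 1
  -- degrees.
  · have h1 := ExtMod.subsingleton_coker (T := ResidueField R)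
      (f := fun i => ((D i).map (algebraMap A R)).mulVecLin)
      (ExtMod.subsingleton_of_isRegularLocalRing R hdim) hloc.1 m
      (fun i hi => hloc.2 i (by omega)) i (by omega)
    have hex' := Matrix.exact_extendScalars (R := R) (S := S) (P := P) (Q := Q) _ rfl
      Ideal.Quotient.mk_surjective hex
    have hsurj' := Matrix.extendScalars_surjective (R := R) (S := S) (P := P) (Q := Q) rfl
      Ideal.Quotient.mk_surjective hφ
    exact ExtMod.subsingleton_of_equiv (hex'.linearEquivOfSurjective hsurj') i
  · obtain ⟨a, ha, rfl⟩ := List.mem_map.1 hr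
    rw [← IsScalarTower.algebraMap_apply, IsScalarTower.algebraMap_apply A (A ⧸ I) S,
      Ideal.Quotient.algebraMap_eq, Ideal.Quotient.eq_zero_iff_mem.2 (hrs a ha), map_zero]

end CohenMacaulay

end OrbitComplex

end

noncomputable section

namespace OrbitComplex

namespace GradedFreeComplex

variable {N n : ℕ} (F : GradedFreeComplex N n)

/-! ### Complexes resolving a quotient of the polynomial ring -/

theorem exists_exact_diffMatrix {B : Type*} [AddCommGroup B] [Module (Poly N) B]
    (e : F.Coker ≃ₗ[Poly N] B) {a b : ℕ} (ha : a = 0) (hb : a + 1 = b) :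
    ∃ φ : (Fin (F.rank a) → Poly N) →ₗ[Poly N] B, Function.Surjective φ ∧
      Function.Exact (F.diffMatrix a b).mulVecLin φ := by
  subst ha
  subst hb
  refine ⟨e.toLinearMap ∘ₗ (LinearMap.range (F.diff 0)).mkQ,
    e.surjective.comp (Submodule.mkQ_surjective _), ?_⟩
  rw [LinearMap.exact_iff, LinearMap.ker_comp, LinearEquiv.ker, ← LinearMap.ker,
    Submodule.ker_mkQ, diffMatrix_succ]
  rfl

/-- For I = 0 the cokernel would be free, and its Ext^n would vanish. -/
theorem annihilator_coker_ne_bot (hn : 0 < n) (h : F.IsExact) (hmin : F.IsMinimal)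
    (hd : F.d (n - 1) ≠ 0) {I : Ideal (Poly N)} (e : F.Coker ≃ₗ[Poly N] Poly N ⧸ I) : I ≠ ⊥ := by
  rintro rfl
  have hproj : Module.Projective (Poly N) F.Coker :=
    Module.Projective.of_equiv (e.trans (Submodule.quotEquivOfEqBot _ rfl)).symm
  refine F.not_subsingleton_ext_coker hn h hmin hd ?_
  obtain ⟨m, rfl⟩ : ∃ m, n = m + 1 := ⟨n - 1, by omega⟩
  exact ExtMod.subsingleton_of_projective _ m

/-- If the cokernel is killed by a non zero polynomial, then the first differential has full
rank. -/
theorem genericRank_zero_of_mem_annihilator {a : Poly N} (ha : a ≠ 0)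
    (hann : a ∈ Module.annihilator (Poly N) F.Coker) : (F.d 0).genericRank = F.rank 0 := by
  have hinj : Function.Injective (F.diff 0).dualMap := by
    rw [injective_iff_map_eq_zero]
    intro φ hφ
    refine LinearMap.ext fun x => ?_
    have h1 : a • x ∈ LinearMap.range (F.diff 0) := by
      rw [← Submodule.Quotient.mk_eq_zero, Submodule.Quotient.mk_smul]
      exact Module.mem_annihilator.1 hann _
    obtain ⟨y, hy⟩ := h1
    have h2 : a • φ x = 0 := by
      rw [← map_smul, ← hy]
      exact LinearMap.congr_fun hφ y
    exact (smul_eq_zero.1 h2).resolve_left ha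
  rw [← Matrix.genericRank_transpose]
  exact Matrix.rank_eq_of_injective _ (Matrix.injective_map_of_isLocalization
    (B := FractionRing (Poly N)) le_rfl ((Matrix.dualMap_mulVecLin_injective_iff _).1 hinj))

theorem isCohenMacaulayRing_of_equiv (hn : 0 < n) (h : F.IsExact) (hdual : F.DualIsExact)
    (hmin : F.IsMinimal) (hd : F.d (n - 1) ≠ 0) {I : Ideal (Poly N)}
    (e : F.Coker ≃ₗ[Poly N] Poly N ⧸ I) : IsCohenMacaulayRing (Poly N ⧸ I) := by
  obtain ⟨rs, hlen, hmem, hreg⟩ := F.exists_isRegular_annihilator hn h hdual hmin hd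
  rw [e.annihilator_eq, Ideal.annihilator_quotient] at hmem
  obtain ⟨m, rfl⟩ : ∃ m, n = m + 1 := ⟨n - 1, by omega⟩
  obtain ⟨φ, hφ, hex⟩ := F.exists_exact_diffMatrix e (a := m + 1 - (m + 1)) (b := m + 1 - m)
    (by omega) (by omega)
  exact isCohenMacaulayRing_quotient ((F.isExact_iff hn).1 h) hφ hex hlen hreg hmem

end GradedFreeComplex

end OrbitComplex

end

/-! ### The main theorem -/

theorem corollary4p4 {N n t : ℕ} {G : Type*} [Group G]
    -- a linear action of `G` on affine space, with finitely many orbits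
    (ρ : Representation ℂ G (Fin N → ℂ))
    -- representatives of the orbits `O_0, …, O_t`
    (p : Fin (t + 1) → (Fin N → ℂ))
    (hp : ∀ x : Fin N → ℂ, ∃! j : Fin (t + 1), x ∈ OrbitComplex.orbit ρ (p j))
    -- a representative of the dense orbit
    (pgen : Fin N → ℂ) (hpgen : OrbitComplex.orbitClosure ρ pgen = Set.univ)
    -- an equivariant minimal complex of graded free modules with non zero differentials
    (hn : 1 ≤ n) (F : OrbitComplex.GradedFreeComplex N n)
    (_E : OrbitComplex.EquivariantStructure ρ F)
    (hmin : F.IsMinimal) (hd : ∀ k < n, F.d k ≠ 0)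
    -- the ranks drop simultaneously at an orbit of minimal codimension
    (hdrop : ∃ j₀ : Fin (t + 1), ∀ k < n, ∀ j : Fin (t + 1),
      F.rankAt k (p j) < F.rankAt k pgen →
        F.rankAt k (p j₀) < F.rankAt k pgen ∧
          OrbitComplex.codim (OrbitComplex.orbitClosure ρ (p j₀)) ≤
            OrbitComplex.codim (OrbitComplex.orbitClosure ρ (p j))) :
    (∑ k ∈ Finset.range (n + 1), (-1 : ℤ) ^ k * (F.rank k : ℤ) = 0 →
      (F.IsExact ↔ F.DualIsExact) ∧
        (F.IsExact → OrbitComplex.IsPerfectModule (OrbitComplex.Poly N) F.Coker)) ∧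
    (F.IsExact → ∀ j : Fin (t + 1),
      Nonempty (F.Coker ≃ₗ[OrbitComplex.Poly N]
        OrbitComplex.CoordRing (OrbitComplex.orbitClosure ρ (p j))) →
      OrbitComplex.IsCohenMacaulayRing
        (OrbitComplex.CoordRing (OrbitComplex.orbitClosure ρ (p j)))) := by
  have hp' : ∀ x, ∃ j, x ∈ OrbitComplex.orbit ρ (p j) := fun x => (hp x).exists
  have hd' : F.d (n - 1) ≠ 0 := hd _ (by omega)
  -- Exactness controls the heights for the leftmost differential, k₀ = n - 1; exactness of the dual
  -- controls them for k₀ = 0.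
  have hdual : F.IsExact → (F.d 0).genericRank = F.rank 0 → F.DualIsExact := fun h h0 =>
    F.dualIsExact_of_forall_le_height hn h0 (F.genericRank_of_isExact hn h).2
      (F.le_height_of_forall_le_height _E hmin hp' hpgen hdrop (k₀ := n - 1) (by omega) hd
        (F.le_height_of_isExact hn h))
  have hprimal : F.DualIsExact → (F.d (n - 1)).genericRank = F.rank n → F.IsExact := fun h h0 =>
    F.isExact_of_forall_le_height hn h0 (F.genericRank_of_dualIsExact hn h).2
      (F.le_height_of_forall_le_height _E hmin hp' hpgen hdrop (k₀ := 0) hn hd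
        (F.le_height_of_dualIsExact hn h))
  refine ⟨fun hsum => ?_, fun h j ⟨e⟩ => ?_⟩
  · have hdual' : F.IsExact → F.DualIsExact := fun h => by
      obtain ⟨h1, h2⟩ := F.genericRank_of_isExact hn h
      rw [F.sum_rank_eq_of_genericRank hn h2, h1, sub_self, mul_zero, add_zero, sub_eq_zero] at hsum
      exact hdual h (by exact_mod_cast hsum.symm)
    refine ⟨⟨hdual', fun h => ?_⟩, fun h => F.isPerfectModule_coker hn h (hdual' h) hmin hd'⟩
    obtain ⟨h1, h2⟩ := F.genericRank_of_dualIsExact hn h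
    rw [F.sum_rank_eq_of_genericRank hn h2, h1, sub_self, zero_add, mul_eq_zero,
      or_iff_right (pow_ne_zero _ (by norm_num)), sub_eq_zero] at hsum
    exact hprimal h (by exact_mod_cast hsum.symm)
  -- A non-zero element of the ideal replaces the assumption on ranks: it kills the cokernel and so
  -- forces full rank of `d 0`.
  · obtain ⟨a, ha, ha0⟩ :=
      (Submodule.ne_bot_iff _).1 (F.annihilator_coker_ne_bot hn h hmin hd' e)
    rw [← Ideal.annihilator_quotient (I := MvPolynomial.vanishingIdeal ℂ _),
      ← e.annihilator_eq] at ha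
    exact F.isCohenMacaulayRing_of_equiv hn h
      (hdual h (F.genericRank_zero_of_mem_annihilator ha0 ha)) hmin hd' e
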